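/- A Stein group is a complex Lie group whose underlying complex manifold $M$ is a Stein manifold, i.e. (1) holomorphic functions on $M$ separate points, (2) every point has a neighbourhood on which finitely many holomorphic functions on $M$ form local coordinates, and (3) for every compact $K\subseteq M$ the set $\{x\in M:\ |u(x)|\le \max_{K}|u|\ \text{for all holomorphic } u \text{ on } M\}$ is compact. A group $G$ is compactly generated if $G=\bigcup_{n\in\mathbb N}K^n$ for some compact $K\subseteq G$. Let $\mathcal A$ be the category of Abelian compactly generated Stein groups and holomorphic homomorphisms. For $G\in\mathcal A$ let $G^\bullet$ be the topological group of all holomorphic homomorphisms $\chi:G\to\mathbb C^\times$, with pointwise multiplication and the topology of uniform convergence on compact sets. A complex manifold structure on $G^\bullet$, compatible with its topology, is called pointwise if a map $f$ from a complex manifold to $G^\bullet$ is holomorphic if and only if it is continuous and $t\mapsto f(t)(x)$ is holomorphic for every $x\in G$; taking identity maps for $f$ one sees that there is at most one such structure and that all evaluations $\chi\mapsto\chi(x)$ are holomorphic for it. **Theorem.** For every Abelian compactly generated Stein group $G$, the group $G^\bullet$ is compactly generated, and it carries a pointwise complex manifold structure, which makes it a Stein group. Thus $G^\bullet$ is again an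 Abelian compactly generated Stein group, and $G\mapsto G^\bullet$, $\varphi\mapsto(\chi\mapsto\chi\circ\varphi)$, is a contravariant functor from $\mathcal A$ to $\mathcal A$. Moreover, the evaluation maps $$ i_G: G\to G^{\bullet\bullet},\qquad i_G(x)(\chi)=\chi(x)\qquad (x\in G,\ \chi\in G^\bullet), $$ form an isomorphism of functors from $G\mapsto G$ to $G\mapsto G^{\bullet\bullet}$ on $\mathcal A$; in particular each $i_G$ is an isomorphism of groups that is biholomorphic, hence a homeomorphism. -/

import Mathlib

open scoped Manifold ContDiff Pointwise
open CategoryTheory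

universe u

/-- The algebra `𝒪(M)`, as a predicate on functions `M → ℂ`: holomorphic functions on a complex
manifold `M` of dimension `n` (complex analytic in charts). -/
def IsHolFun (n : ℕ) (M : Type u) [TopologicalSpace M] [ChartedSpace (Fin n → ℂ) M]
    (f : M → ℂ) : Prop :=
  ContMDiff 𝓘(ℂ, Fin n → ℂ) 𝓘(ℂ, ℂ) ω f

/-- The holomorphically convex hull of a compact set `K`: the points `x` with
`|f x| ≤ max_{y ∈ K} |f y|` for every holomorphic function `f`. -/
def holomorphicHull (n : ℕ) (M : Type u) [TopologicalSpace M] [ChartedSpace (Fin n → ℂ) M]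
    (K : Set M) : Set M :=
  {x | ∀ f : M → ℂ, IsHolFun n M f → ∃ y ∈ K, ‖f x‖ ≤ ‖f y‖}

/-- Stein manifolds of dimension `n`. -/
structure IsSteinManifold (n : ℕ) (M : Type u) [TopologicalSpace M]
    [ChartedSpace (Fin n → ℂ) M] : Prop where
  isManifold : IsManifold 𝓘(ℂ, Fin n → ℂ) ω M
  /-- Holomorphic separability. -/
  separable : ∀ x y : M, x ≠ y → ∃ f : M → ℂ, IsHolFun n M f ∧ f x ≠ f y
  /-- Holomorphic uniformization: global holomorphic functions give local coordinates. -/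
  uniformizable : ∀ x : M, ∃ f : Fin n → M → ℂ, (∀ j, IsHolFun n M (f j)) ∧
    IsLocalDiffeomorphAt 𝓘(ℂ, Fin n → ℂ) 𝓘(ℂ, Fin n → ℂ) ω (fun y j => f j y) x
  /-- Holomorphic convexity. -/
  convex : ∀ K : Set M, IsCompact K → IsCompact (holomorphicHull n M K)

/-- A structure of a Stein group on an abelian group with a topology: a complex manifold structure
of some dimension, compatible with the topology, for which the group is a complex Lie group and a
Stein manifold. -/
structure SteinGroupStructure (A : Type u) [CommGroup A] [TopologicalSpace A] where
  dim : ℕ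
  charts : ChartedSpace (Fin dim → ℂ) A
  isLieGroup : LieGroup 𝓘(ℂ, Fin dim → ℂ) ω A
  isStein : IsSteinManifold dim A

/-- A group with a topology is compactly generated if it is the union of the powers of a compact
subset. -/
def IsCompactlyGeneratedGroup (A : Type u) [CommGroup A] [TopologicalSpace A] : Prop :=
  ∃ K : Set A, IsCompact K ∧ ⋃ n : ℕ, K ^ n = Set.univ

/-- Abelian compactly generated Stein groups. -/
structure AbSteinGrp : Type (u + 1) where
  carrier : Type u
  [commGroup : CommGroup carrier]
  [topology : TopologicalSpace carrier]
  stein : SteinGroupStructure carrier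
  compactlyGenerated : IsCompactlyGeneratedGroup carrier

namespace AbSteinGrp

instance : CoeSort AbSteinGrp.{u} (Type u) := ⟨carrier⟩

instance (G : AbSteinGrp.{u}) : CommGroup G := G.commGroup

instance (G : AbSteinGrp.{u}) : TopologicalSpace G := G.topology

/-- The complex dimension. -/
abbrev dim (G : AbSteinGrp.{u}) : ℕ := G.stein.dim

instance (G : AbSteinGrp.{u}) : ChartedSpace (Fin G.dim → ℂ) G := G.stein.charts

instance (G : AbSteinGrp.{u}) : LieGroup 𝓘(ℂ, Fin G.dim → ℂ) ω G := G.stein.isLieGroup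

/-- Morphisms: holomorphic group homomorphisms. -/
structure Hom (G H : AbSteinGrp.{u}) where
  toMonoidHom : G →* H
  holomorphic : ContMDiff 𝓘(ℂ, Fin G.dim → ℂ) 𝓘(ℂ, Fin H.dim → ℂ) ω toMonoidHom

/-- The category of abelian compactly generated Stein groups and holomorphic homomorphisms. -/
instance : Category AbSteinGrp.{u} where
  Hom := Hom
  id G := ⟨MonoidHom.id G, contMDiff_id⟩
  comp f g := ⟨g.toMonoidHom.comp f.toMonoidHom, g.holomorphic.comp f.holomorphic⟩

instance (G H : AbSteinGrp.{u}) : CoeFun (G ⟶ H) (fun _ => G → H) :=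
  ⟨fun f => f.toMonoidHom⟩

/-- The group `G^•` of holomorphic characters `G → ℂˣ`, with pointwise multiplication and the
compact-open topology (uniform convergence on compact sets). -/
noncomputable def dual (G : AbSteinGrp.{u}) : Subgroup (G →ₜ* ℂˣ) where
  carrier := {χ | ContMDiff 𝓘(ℂ, Fin G.dim → ℂ) 𝓘(ℂ, ℂ) ω (χ : G → ℂˣ)}
  mul_mem' h₁ h₂ := ContMDiff.mul h₁ h₂
  one_mem' := contMDiff_const
  inv_mem' h := ContMDiff.inv h

/-- A Stein group structure `s` on `G^•` is a dual structure if a map `f` from a complex manifold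
to `G^•` is holomorphic exactly when it is continuous and all the functions `t ↦ f(t)(x)`, `x ∈ G`,
are holomorphic. By the usual argument (applied to identity maps) such a complex structure is
unique, and all the evaluations `χ ↦ χ(x)` are holomorphic for it. -/
def IsDualStructure (G : AbSteinGrp.{u}) (s : SteinGroupStructure G.dual) : Prop :=
  ∀ (k : ℕ) (M : Type u) [TopologicalSpace M] [ChartedSpace (Fin k → ℂ) M]
    [IsManifold 𝓘(ℂ, Fin k → ℂ) ω M] (f : M → G.dual),
    letI := s.charts
    ContMDiff 𝓘(ℂ, Fin k → ℂ) 𝓘(ℂ, Fin s.dim → ℂ) ω f ↔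
      Continuous f ∧ ∀ x : G, ContMDiff 𝓘(ℂ, Fin k → ℂ) 𝓘(ℂ, ℂ) ω (fun t => (f t).1 x)

/-- `G^•` as an abelian compactly generated Stein group, for a given Stein group structure. -/
noncomputable abbrev dualObj (G : AbSteinGrp.{u}) (s : SteinGroupStructure G.dual)
    (h : IsCompactlyGeneratedGroup G.dual) : AbSteinGrp.{u} where
  carrier := G.dual
  stein := s
  compactlyGenerated := h

/-- The homomorphism `φ^• : H^• → G^•`, `χ ↦ χ ∘ φ`. -/
noncomputable def dualMap {G H : AbSteinGrp.{u}} (φ : G ⟶ H) : H.dual →* G.dual where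
  toFun χ := ⟨χ.1.comp ⟨φ.toMonoidHom, φ.holomorphic.continuous⟩,
    ContMDiff.comp (g := (χ.1 : H → ℂˣ)) (f := φ.toMonoidHom) (show ContMDiff _ _ _ _ from χ.2)
      φ.holomorphic⟩
  map_one' := rfl
  map_mul' _ _ := rfl

theorem continuous_dualMap {G H : AbSteinGrp.{u}} (φ : G ⟶ H) : Continuous (dualMap φ) :=
  Continuous.subtype_mk ((ContinuousMonoidHom.continuous_comp_left
    ⟨φ.toMonoidHom, φ.holomorphic.continuous⟩).comp continuous_subtype_val) _

theorem holomorphic_dualMap {G H : AbSteinGrp.{u}} (φ : G ⟶ H)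
    (s : SteinGroupStructure G.dual) (hs : IsDualStructure G s)
    (t : SteinGroupStructure H.dual) (ht : IsDualStructure H t) :
    letI := s.charts
    letI := t.charts
    ContMDiff 𝓘(ℂ, Fin t.dim → ℂ) 𝓘(ℂ, Fin s.dim → ℂ) ω (dualMap φ) := by
  let := t.charts
  have := t.isStein.isManifold
  exact (hs t.dim H.dual (dualMap φ)).2
    ⟨continuous_dualMap φ, fun x => ((ht t.dim H.dual id).1 contMDiff_id).2 (φ x)⟩

/-- The contravariant functor `G ↦ G^•`, `φ ↦ (χ ↦ χ ∘ φ)`. -/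
noncomputable def dualFunctor (s : ∀ G : AbSteinGrp.{u}, SteinGroupStructure G.dual)
    (hs : ∀ G, IsDualStructure G (s G))
    (hc : ∀ G : AbSteinGrp.{u}, IsCompactlyGeneratedGroup G.dual) :
    AbSteinGrp.{u}ᵒᵖ ⥤ AbSteinGrp.{u} where
  obj G := G.unop.dualObj (s G.unop) (hc G.unop)
  map φ := ⟨dualMap φ.unop, holomorphic_dualMap φ.unop _ (hs _) _ (hs _)⟩
  map_id _ := rfl
  map_comp _ _ := rfl

end AbSteinGrp

/-! Up to isomorphism `G` is a product `(ℂˣ)^κ × ℂ^κ' × ℤ^j × F` with `F` finite, and for each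
factor duality is explicit: `ℂ` is dual to itself by `exp (z w)`, `ℂˣ` and `ℤ` are dual to each
other by `x ^ k`, and `F` is dual to its finite group of characters. Such pairings are stable under
finite products and isomorphisms, so `G` and `G^•` stand in a symmetric duality
(`IsPerfectPairing`), and reflexivity comes from exchanging its two sides.

The product decomposition starts from a holomorphic exponential map `ℂ^n → G`
(`LieGroup.exists_isHolExp`), whose kernel is discrete. The decisive point is
`IsHolExp.linearIndependent_of_separable`: a complex relation between periods that are independent
over `ℝ` would produce a complex line mapped into a compact set. By Liouville every holomorphic
function is constant on its image, against separation of points. Hence a lattice basis of the kernel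
extends to a basis of `ℂ^n`, and the image of the exponential map is an open subgroup `(ℂˣ)^κ ×
ℂ^κ'`. This subgroup is divisible, so it splits off; the quotient is discrete, and finitely
generated because `G` is compactly generated (`IsHolExp.exists_isPerfectPairing`).

The model dual is identified with `G^•`, including the topology, in `exists_mulEquiv_dual`. Its
exponential map supplies charts whose transition maps are local translations. Evaluations at points
of `G` are characters of `G^•` that separate points: by `IsSeparatingFamily.contMDiff_iff` they test
holomorphy, so the structure is pointwise, and by `IsExp.isSteinManifold` they yield the Stein
conditions, holomorphic convexity because pointwise bounded sets of characters are relatively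
compact. -/

open Filter Topology

/-! ### Analyticity from an analytic derivative -/

/-- The termwise primitive, with constant term `c`, of a series with values in linear maps. -/
noncomputable def FormalMultilinearSeries.primitive {E F : Type*} [NormedAddCommGroup E]
    [NormedSpace ℂ E] [NormedAddCommGroup F] [NormedSpace ℂ F]
    (p : FormalMultilinearSeries ℂ E (E →L[ℂ] F)) (c : F) : FormalMultilinearSeries ℂ E F
  | 0 => ContinuousMultilinearMap.uncurry0 ℂ E c
  | n + 1 => (1 / (n + 1) : ℝ) • p.unshift c (n + 1)

theorem FormalMultilinearSeries.primitive_succ_apply {E F : Type*} [NormedAddCommGroup E]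
    [NormedSpace ℂ E] [NormedAddCommGroup F] [NormedSpace ℂ F]
    (p : FormalMultilinearSeries ℂ E (E →L[ℂ] F)) (c : F) (n : ℕ) (y : E) :
    p.primitive c (n + 1) (fun _ => y) = (1 / (n + 1) : ℝ) • p n (fun _ => y) y :=
  rfl

theorem FormalMultilinearSeries.norm_primitive_succ_le {E F : Type*} [NormedAddCommGroup E]
    [NormedSpace ℂ E] [NormedAddCommGroup F] [NormedSpace ℂ F]
    (p : FormalMultilinearSeries ℂ E (E →L[ℂ] F)) (c : F) (n : ℕ) :
    ‖p.primitive c (n + 1)‖ ≤ ‖p n‖ := by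
  have h1 : ‖p.unshift c (n + 1)‖ = ‖p n‖ := ContinuousMultilinearMap.uncurryRight_norm _
  have h2 : ‖p.primitive c (n + 1)‖ = ‖(1 / (n + 1) : ℝ)‖ * ‖p.unshift c (n + 1)‖ :=
    norm_smul _ _
  rw [h2, h1]
  have h3 : 0 ≤ ‖p n‖ := (p n).opNorm_nonneg
  refine mul_le_of_le_one_left h3 ?_
  rw [Real.norm_of_nonneg (by positivity)]
  refine div_le_one_of_le₀ ?_ (by positivity)
  linarith [Nat.cast_nonneg (α := ℝ) n]

/-- On the segment the `n`-th term is `t ^ n` times a constant, so integration produces the factor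
`1 / (n + 1)`. Dominated convergence applies with the majorant `‖p n‖ * ‖y‖ ^ n * ‖y‖`, summable
inside the ball. -/
theorem HasFPowerSeriesOnBall.hasSum_integral_segment {E F : Type*} [NormedAddCommGroup E]
    [NormedSpace ℂ E] [NormedAddCommGroup F] [NormedSpace ℂ F] [CompleteSpace F]
    {f' : E → E →L[ℂ] F} {p : FormalMultilinearSeries ℂ E (E →L[ℂ] F)} {x y : E} {r : ENNReal}
    (hp : HasFPowerSeriesOnBall f' p x r)
    (hy : ‖y‖ₑ < r) :
    HasSum (fun n : ℕ => (1 / (n + 1) : ℝ) • p n (fun _ => y) y)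
      (∫ t in (0 : ℝ)..1, f' (x + (t : ℂ) • y) y) := by
  have hseg : ∀ t ∈ Set.uIoc (0 : ℝ) 1, ((t : ℂ) • y) ∈ Metric.eball (0 : E) r := by
    intro t ht
    rw [Set.uIoc_of_le zero_le_one] at ht
    have h1 : ‖(t : ℂ)‖ ≤ 1 := by
      rw [Complex.norm_real, Real.norm_eq_abs, abs_of_pos ht.1]; exact ht.2
    have : ‖(t : ℂ) • y‖ ≤ ‖y‖ := by
      rw [norm_smul]
      exact mul_le_of_le_one_left (norm_nonneg _) h1
    simp only [Metric.mem_eball, edist_zero_right]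
    exact lt_of_le_of_lt (enorm_le_iff_norm_le.2 this) hy
  have hsum : Summable fun n => ‖p n‖ * ‖y‖ ^ n * ‖y‖ :=
    Summable.mul_right _ (p.summable_norm_mul_pow (r := ‖y‖₊) (lt_of_lt_of_le hy hp.r_le))
  have hbound : ∀ n, ∀ t ∈ Set.uIoc (0 : ℝ) 1,
      ‖(t ^ n) • (p n (fun _ => y) y)‖ ≤ ‖p n‖ * ‖y‖ ^ n * ‖y‖ := by
    intro n t ht
    rw [Set.uIoc_of_le zero_le_one] at ht
    rw [norm_smul, norm_pow, Real.norm_eq_abs, abs_of_pos ht.1]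
    refine (mul_le_of_le_one_left (norm_nonneg _) (pow_le_one₀ ht.1.le ht.2)).trans ?_
    refine ((p n (fun _ => y)).le_opNorm y).trans ?_
    gcongr
    simpa using (p n).le_opNorm (fun _ => y)
  have hlim : ∀ t ∈ Set.uIoc (0 : ℝ) 1,
      HasSum (fun n => (t ^ n) • (p n (fun _ => y) y)) (f' (x + (t : ℂ) • y) y) := by
    intro t ht
    have h1 := (hp.hasSum (hseg t ht)).mapL (ContinuousLinearMap.apply ℂ F y)
    have h2 : ∀ n, p n (fun _ => (t : ℂ) • y) y = (t ^ n) • (p n (fun _ => y) y) := by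
      intro n
      have h2 := (p n).map_smul_univ (fun _ => (t : ℂ)) (fun _ => y)
      rw [h2, Finset.prod_const, Finset.card_univ, Fintype.card_fin, ← Complex.ofReal_pow,
        _root_.smul_apply, Complex.coe_smul]
    simpa only [ContinuousLinearMap.apply_apply, h2] using h1
  have key := intervalIntegral.hasSum_integral_of_dominated_convergence
    (μ := MeasureTheory.volume) (a := (0 : ℝ)) (b := 1)
    (F := fun (n : ℕ) (t : ℝ) => (t ^ n) • (p n (fun _ => y) y))
    (f := fun t => f' (x + (t : ℂ) • y) y)
    (fun n _ => ‖p n‖ * ‖y‖ ^ n * ‖y‖)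
    (fun n => ((continuous_pow n).smul continuous_const).aestronglyMeasurable)
    (fun n => Eventually.of_forall (hbound n))
    (Eventually.of_forall fun t _ => hsum) intervalIntegrable_const
    (Eventually.of_forall hlim)
  refine key.congr_fun fun n => ?_
  rw [intervalIntegral.integral_smul_const, integral_pow]
  simp

/-- A function with an analytic Fréchet derivative is analytic. -/
theorem analyticAt_of_hasFDerivAt {E F : Type*} [NormedAddCommGroup E] [NormedSpace ℂ E]
    [NormedAddCommGroup F] [NormedSpace ℂ F] [CompleteSpace F]
    {f : E → F} {f' : E → E →L[ℂ] F} {x : E}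
    (hf : ∀ᶠ y in 𝓝 x, HasFDerivAt f (f' y) y) (hf' : AnalyticAt ℂ f' x) :
    AnalyticAt ℂ f x := by
  obtain ⟨p, r₁, hp₁⟩ := hf'
  obtain ⟨r₂, hr₂, hball⟩ := EMetric.mem_nhds_iff.1 hf
  set r := min r₁ r₂ with hr
  have hr0 : 0 < r := lt_min hp₁.r_pos hr₂
  have hp : HasFPowerSeriesOnBall f' p x r := hp₁.mono hr0 (min_le_left _ _)
  have hd : ∀ y ∈ Metric.eball x r, HasFDerivAt f (f' y) y := fun y hy =>
    hball (Metric.eball_subset_eball (min_le_right _ _) hy)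
  -- Integrating termwise does not increase the norms of the coefficients, so the primitive
  -- converges at least where `p` does; the fundamental theorem of calculus along segments from `x`
  -- shows that its sum is `f`.
  set q' : FormalMultilinearSeries ℂ E F := p.primitive (f x) with hq'
  have hnorm : ∀ n, ‖q' (n + 1)‖ ≤ ‖p n‖ := p.norm_primitive_succ_le (f x)
  refine ⟨q', r, ?_, hr0, ?_⟩
  · refine ENNReal.le_of_forall_nnreal_lt fun s hs => ?_
    obtain ⟨C, hC, hCb⟩ := p.norm_mul_pow_le_of_lt_radius (hs.trans_le hp.r_le)
    refine q'.le_radius_of_bound (max ‖q' 0‖ (C * s)) fun n => ?_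
    cases n with
    | zero => simp
    | succ n =>
      refine le_max_of_le_right ?_
      calc ‖q' (n + 1)‖ * (s : ℝ) ^ (n + 1) ≤ ‖p n‖ * (s : ℝ) ^ (n + 1) := by
            gcongr; exact hnorm n
        _ = (‖p n‖ * s ^ n) * s := by ring
        _ ≤ C * s := by gcongr; exact hCb n
  · intro y hy
    have hseg : ∀ t ∈ Set.Icc (0 : ℝ) 1, ((t : ℂ) • y) ∈ Metric.eball (0 : E) r := by
      intro t ht
      have h1 : ‖(t : ℂ)‖ ≤ 1 := by
        rw [Complex.norm_real, Real.norm_eq_abs, abs_of_nonneg ht.1]; exact ht.2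
      have : ‖(t : ℂ) • y‖ ≤ ‖y‖ := by
        rw [norm_smul]
        exact mul_le_of_le_one_left (norm_nonneg _) h1
      simp only [Metric.mem_eball, edist_zero_right] at hy ⊢
      exact lt_of_le_of_lt (enorm_le_iff_norm_le.2 this) hy
    have hmem : ∀ z ∈ Metric.eball (0 : E) r, x + z ∈ Metric.eball x r := by
      intro z hz
      simpa [Metric.mem_eball, edist_eq_enorm_sub] using hz
    have hder : ∀ t ∈ Set.Icc (0 : ℝ) 1,
        HasDerivAt (fun t : ℝ => f (x + (t : ℂ) • y)) (f' (x + (t : ℂ) • y) y) t := by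
      intro t ht
      have h1 : HasDerivAt (fun t : ℝ => x + (t : ℂ) • y) y t := by
        simpa using ((Complex.ofRealCLM.hasDerivAt (x := t)).smul_const y).const_add x
      exact ((hd _ (hmem _ (hseg t ht))).restrictScalars ℝ).comp_hasDerivAt t h1
    have hcont : ContinuousOn (fun t : ℝ => f' (x + (t : ℂ) • y) y) (Set.uIcc 0 1) := by
      rw [Set.uIcc_of_le zero_le_one]
      refine ContinuousOn.clm_apply ?_ continuousOn_const
      refine hp.continuousOn.comp (by fun_prop) fun t ht => hmem _ (hseg t ht)
    have hint := intervalIntegral.integral_eq_sub_of_hasDerivAt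
      (fun t ht => hder t (by rwa [Set.uIcc_of_le zero_le_one] at ht)) hcont.intervalIntegrable
    have key := hp.hasSum_integral_segment (y := y) (by simpa [Metric.mem_eball] using hy)
    rw [hint] at key
    rw [← hasSum_nat_add_iff' 1]
    simp only [Finset.range_one, Finset.sum_singleton]
    have h0 : q' 0 (fun _ => y) = f x := rfl
    rw [h0]
    simpa [hq', FormalMultilinearSeries.primitive_succ_apply] using key

/-! ### Linearization of a commutative local group law -/

theorem AnalyticAt.isBigO_sub_fderiv {E F : Type*} [NormedAddCommGroup E] [NormedSpace ℂ E]
    [NormedAddCommGroup F] [NormedSpace ℂ F] {f : E → F} {f' : E →L[ℂ] F}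
    (hf : AnalyticAt ℂ f 0) (hf' : HasFDerivAt f f' 0) :
    (fun y => f y - f 0 - f' y) =O[𝓝 0] fun y => ‖y‖ ^ 2 := by
  obtain ⟨p, hp⟩ := hf
  have h := hp.isBigO_sub_partialSum_pow 2
  have h1 : f' = continuousMultilinearCurryFin1 ℂ E F (p 1) := hf'.unique hp.hasFDerivAt
  have h0 : ∀ v, p 0 v = f 0 := fun v => hp.coeff_zero v
  refine h.congr_left fun y => ?_
  simp only [zero_add, FormalMultilinearSeries.partialSum, Finset.sum_range_succ,
    Finset.range_zero, Finset.sum_empty, h0, h1]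
  rw [sub_sub]
  congr 2

theorem AnalyticAt.exists_local_inverse {E : Type*} [NormedAddCommGroup E] [NormedSpace ℂ E]
    [CompleteSpace E] {s : E → E} (hs : AnalyticAt ℂ s 0) (h0 : s 0 = 0) {e : E ≃L[ℂ] E}
    (hs' : HasFDerivAt s (e : E →L[ℂ] E) 0) :
    ∃ r : E → E, AnalyticAt ℂ r 0 ∧ r 0 = 0 ∧ HasFDerivAt r (e.symm : E →L[ℂ] E) 0 ∧
      (∀ᶠ x in 𝓝 0, s (r x) = x) ∧ ∀ᶠ x in 𝓝 0, r (s x) = x := by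
  have hc : ContDiffAt ℂ ω s 0 := hs.contDiffAt
  have hst : HasStrictFDerivAt s (e : E →L[ℂ] E) 0 := hc.hasStrictFDerivAt' hs' (by simp)
  have hr : hst.localInverse s e 0 0 = 0 := by
    have := hst.localInverse_apply_image
    rwa [h0] at this
  refine ⟨hst.localInverse s e 0, ?_, hr, ?_, ?_, hst.eventually_left_inverse⟩
  · have := hc.to_localInverse hs' (by simp)
    rw [h0] at this
    exact this.analyticAt
  · have := hst.to_localInverse.hasFDerivAt
    rwa [h0] at this
  · have := hst.eventually_right_inverse
    rwa [h0] at this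

/-- Koenigs linearization of a germ with derivative `1/2`. -/
theorem AnalyticAt.exists_linearization {E : Type*} [NormedAddCommGroup E] [NormedSpace ℂ E]
    [CompleteSpace E] {r : E → E} (hr : AnalyticAt ℂ r 0) (h0 : r 0 = 0)
    (hr' : HasFDerivAt r ((1 / 2 : ℂ) • ContinuousLinearMap.id ℂ E) 0) :
    ∃ (L : E → E) (δ C : ℝ), 0 < δ ∧ ∀ x, ‖x‖ < δ →
      (∀ k, ‖r^[k] x‖ ≤ (2 / 3 : ℝ) ^ k * ‖x‖) ∧
      Tendsto (fun k => (2 : ℂ) ^ k • r^[k] x) atTop (𝓝 (L x)) ∧ ‖L x - x‖ ≤ C * ‖x‖ ^ 2 := by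
  obtain ⟨C, hC, hb⟩ := (hr.isBigO_sub_fderiv hr').exists_pos
  obtain ⟨δ₀, hδ₀, hball⟩ := Metric.eventually_nhds_iff_ball.1 hb.bound
  -- Below `1 / (6 * C)` the quadratic error is at most `‖x‖ / 6`, and `1/2 + 1/6 = 2/3` is the
  -- contraction factor.
  set δ := min δ₀ (1 / (6 * C)) with hδ
  have hδpos : 0 < δ := lt_min hδ₀ (by positivity)
  have hq : ∀ x, ‖x‖ < δ → ‖r x - (1 / 2 : ℂ) • x‖ ≤ C * ‖x‖ ^ 2 := by
    intro x hx
    have := hball x (by simpa using hx.trans_le (min_le_left _ _))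
    simpa [h0] using this
  have hhalf : ∀ x : E, ‖(1 / 2 : ℂ) • x‖ = 1 / 2 * ‖x‖ := by
    intro x
    rw [norm_smul]
    norm_num
  have hcontr : ∀ x, ‖x‖ < δ → ‖r x‖ ≤ 2 / 3 * ‖x‖ := by
    intro x hx
    have h1 := hq x hx
    have h2 : C * ‖x‖ ≤ 1 / 6 := by
      have h3 : ‖x‖ ≤ 1 / (6 * C) := (hx.trans_le (min_le_right _ _)).le
      rw [le_div_iff₀ (by positivity)] at h3
      linarith
    have h4 : ‖r x‖ ≤ ‖r x - (1 / 2 : ℂ) • x‖ + ‖(1 / 2 : ℂ) • x‖ := by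
      simpa using norm_add_le (r x - (1 / 2 : ℂ) • x) ((1 / 2 : ℂ) • x)
    rw [hhalf] at h4
    nlinarith [norm_nonneg x]
  have hiter : ∀ x, ‖x‖ < δ → ∀ k, ‖r^[k] x‖ ≤ (2 / 3 : ℝ) ^ k * ‖x‖ := by
    intro x hx k
    induction k with
    | zero => simp
    | succ k ih =>
      have h1 : ‖r^[k] x‖ < δ := by
        refine (ih.trans ?_).trans_lt hx
        exact mul_le_of_le_one_left (norm_nonneg _) (pow_le_one₀ (by norm_num) (by norm_num))
      rw [Function.iterate_succ_apply', pow_succ]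
      linarith [hcontr _ h1]
  -- The error at stage `k` is quadratic in `(2/3) ^ k`, which beats the factor `2 ^ k`: the ratio
  -- is `2 * (2/3)² = 8/9 < 1`.
  have hdist : ∀ x, ‖x‖ < δ → ∀ k, dist ((2 : ℂ) ^ k • r^[k] x) ((2 : ℂ) ^ (k + 1) • r^[k + 1] x)
      ≤ (2 * C * ‖x‖ ^ 2) * (8 / 9 : ℝ) ^ k := by
    intro x hx k
    have h1 : ‖r^[k] x‖ < δ := by
      refine ((hiter x hx k).trans ?_).trans_lt hx
      exact mul_le_of_le_one_left (norm_nonneg _) (pow_le_one₀ (by norm_num) (by norm_num))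
    have h2 : (2 : ℂ) ^ (k + 1) • r^[k + 1] x - (2 : ℂ) ^ k • r^[k] x =
        (2 : ℂ) ^ (k + 1) • (r (r^[k] x) - (1 / 2 : ℂ) • r^[k] x) := by
      rw [smul_sub, smul_smul, Function.iterate_succ_apply']
      congr 2
      rw [pow_succ]; ring
    rw [dist_comm, dist_eq_norm, h2, norm_smul]
    have h3 : ‖(2 : ℂ) ^ (k + 1)‖ = 2 ^ (k + 1) := by simp
    rw [h3]
    calc (2 : ℝ) ^ (k + 1) * ‖r (r^[k] x) - (1 / 2 : ℂ) • r^[k] x‖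
        ≤ 2 ^ (k + 1) * (C * ‖r^[k] x‖ ^ 2) := by gcongr; exact hq _ h1
      _ ≤ 2 ^ (k + 1) * (C * ((2 / 3 : ℝ) ^ k * ‖x‖) ^ 2) := by gcongr; exact hiter x hx k
      _ = (2 * C * ‖x‖ ^ 2) * (8 / 9 : ℝ) ^ k := by
        have : (8 / 9 : ℝ) ^ k = 2 ^ k * ((2 / 3 : ℝ) ^ k) ^ 2 := by
          rw [← pow_mul, mul_comm k 2, pow_mul, ← mul_pow]; norm_num
        rw [this]; ring
  have hconv : ∀ x, ‖x‖ < δ → ∃ l, Tendsto (fun k => (2 : ℂ) ^ k • r^[k] x) atTop (𝓝 l) :=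
    fun x hx => cauchySeq_tendsto_of_complete
      (cauchySeq_of_le_geometric _ _ (by norm_num) (hdist x hx))
  choose! L hL using hconv
  -- The geometric series sums to `2C / (1 - 8/9) = 18C`.
  refine ⟨L, δ, 18 * C, hδpos, fun x hx => ⟨hiter x hx, hL x hx, ?_⟩⟩
  have := dist_le_of_le_geometric_of_tendsto₀ _ _ (by norm_num) (hdist x hx) (hL x hx)
  rw [dist_comm, dist_eq_norm] at this
  simp only [pow_zero, one_smul, Function.iterate_zero, id] at this
  refine this.trans (le_of_eq ?_)
  ring

/-- A commutative analytic local group law is linearized by a logarithm. -/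
theorem AnalyticAt.exists_local_log {E : Type*} [NormedAddCommGroup E] [NormedSpace ℂ E]
    [CompleteSpace E] {F D : E × E → E} (hF : AnalyticAt ℂ F 0)
    (hleft : ∀ᶠ x in 𝓝 (0 : E), F (0, x) = x) (hright : ∀ᶠ x in 𝓝 (0 : E), F (x, 0) = x)
    (hmedial : ∀ᶠ p in 𝓝 (0 : E × E), F (F p, F p) = F (F (p.1, p.1), F (p.2, p.2)))
    (hD : AnalyticAt ℂ D 0) (hDdiag : ∀ᶠ x in 𝓝 (0 : E), D (x, x) = 0)
    (hDF : ∀ᶠ p in 𝓝 (0 : E × E), F (p.1, D p) = p.2) :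
    ∃ L : E → E, AnalyticAt ℂ L 0 ∧ L 0 = 0 ∧
      HasFDerivAt L (ContinuousLinearMap.id ℂ E) 0 ∧
      ∀ᶠ p in 𝓝 (0 : E × E), L (F p) = L p.1 + L p.2 := by
  have hF0 : F 0 = 0 := hleft.self_of_nhds
  have hD0 : D 0 = 0 := hDdiag.self_of_nhds
  have hcF : Tendsto F (𝓝 0) (𝓝 0) := by simpa [hF0] using hF.continuousAt.tendsto
  have hF' : HasFDerivAt F (ContinuousLinearMap.fst ℂ E E + ContinuousLinearMap.snd ℂ E E) 0 := by
    have h := hF.differentiableAt.hasFDerivAt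
    refine h.congr_fderiv ?_
    have h1 : HasFDerivAt (fun x : E => F (x, 0))
        ((fderiv ℂ F 0).comp (ContinuousLinearMap.inl ℂ E E)) 0 :=
      HasFDerivAt.comp (0 : E) (f := fun x : E => (x, (0 : E))) h
        (ContinuousLinearMap.inl ℂ E E).hasFDerivAt
    have h2 : HasFDerivAt (fun x : E => F (0, x))
        ((fderiv ℂ F 0).comp (ContinuousLinearMap.inr ℂ E E)) 0 :=
      HasFDerivAt.comp (0 : E) (f := fun x : E => ((0 : E), x)) h
        (ContinuousLinearMap.inr ℂ E E).hasFDerivAt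
    have h1' := h1.unique ((hasFDerivAt_id (0 : E)).congr_of_eventuallyEq hright)
    have h2' := h2.unique ((hasFDerivAt_id (0 : E)).congr_of_eventuallyEq hleft)
    ext x
    · simpa using DFunLike.congr_fun h1' x
    · simpa using DFunLike.congr_fun h2' x
  -- the squaring map and its inverse
  have hdiag : AnalyticAt ℂ (fun x : E => (x, x)) 0 := analyticAt_id.prod analyticAt_id
  have hs : AnalyticAt ℂ (fun x : E => F (x, x)) 0 := hF.comp_of_eq hdiag rfl
  let e : E ≃L[ℂ] E := ContinuousLinearEquiv.smulLeft (Units.mk0 (2 : ℂ) two_ne_zero)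
  have hs' : HasFDerivAt (fun x : E => F (x, x)) (e : E →L[ℂ] E) 0 := by
    have h1 : HasFDerivAt (fun x : E => (x, x))
      ((ContinuousLinearMap.id ℂ E).prod (ContinuousLinearMap.id ℂ E)) 0 :=
      (hasFDerivAt_id (0 : E)).prodMk (hasFDerivAt_id (0 : E))
    have h2 := HasFDerivAt.comp (0 : E) (f := fun x : E => (x, x)) hF' h1
    refine h2.congr_fderiv ?_
    ext x
    exact (two_smul ℂ x).symm
  obtain ⟨r, hr, hr0, hr', hsr, hrs⟩ := hs.exists_local_inverse hF0 hs'
  have hr'' : HasFDerivAt r ((1 / 2 : ℂ) • ContinuousLinearMap.id ℂ E) 0 := by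
    refine hr'.congr_fderiv ?_
    ext x
    change (2 : ℂ)⁻¹ • x = (1 / 2 : ℂ) • x
    rw [one_div]
  obtain ⟨L, δ, C, hδ, hL⟩ := hr.exists_linearization hr0 hr''
  have hcr : Tendsto r (𝓝 0) (𝓝 0) := by simpa [hr0] using hr.continuousAt.tendsto
  -- roots are multiplicative
  have hrr : Tendsto (fun p : E × E => (r p.1, r p.2)) (𝓝 0) (𝓝 0) :=
    (hcr.prodMap hcr).mono_left nhds_prod_eq.le |>.mono_right nhds_prod_eq.ge
  have hmul : ∀ᶠ p in 𝓝 (0 : E × E), r (F p) = F (r p.1, r p.2) := by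
    have hf1 : Tendsto Prod.fst (𝓝 (0 : E × E)) (𝓝 0) := continuous_fst.tendsto 0
    have hf2 : Tendsto Prod.snd (𝓝 (0 : E × E)) (𝓝 0) := continuous_snd.tendsto 0
    -- By the medial law, the square of `F (r x, r y)` is the product of the squares of `r x` and `r
    -- y`, that is `F (x, y)`; applying the local inverse `r` of squaring gives the claim.
    filter_upwards [hrr.eventually hmedial, (hcF.comp hrr).eventually hrs, hf1.eventually hsr,
      hf2.eventually hsr] with p h1 h2 h3 h4
    simp only [Function.comp] at h2
    rw [h1] at h2
    rw [h3, h4] at h2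
    exact h2
  have hL0 : L 0 = 0 := by
    have := (hL 0 (by simpa using hδ)).2.2
    simpa using this
  have hLlin : HasFDerivAt L (ContinuousLinearMap.id ℂ E) 0 := by
    rw [hasFDerivAt_iff_isLittleO_nhds_zero]
    have h1 : (fun h : E => L (0 + h) - L 0 - ContinuousLinearMap.id ℂ E h) =O[𝓝 0]
        fun h => ‖h‖ ^ 2 := by
      refine Asymptotics.IsBigO.of_bound C ?_
      filter_upwards [Metric.ball_mem_nhds (0 : E) hδ] with h hh
      simpa [hL0] using (hL h (by simpa using hh)).2.2
    exact h1.trans_isLittleO (Asymptotics.isLittleO_norm_pow_id one_lt_two)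
  have hadd : ∀ᶠ p in 𝓝 (0 : E × E), L (F p) = L p.1 + L p.2 := by
    obtain ⟨K, hK, hKb⟩ := (hF.isBigO_sub_fderiv hF').exists_pos
    obtain ⟨ε, hε, hball⟩ := Metric.eventually_nhds_iff_ball.1 (hmul.and hKb.bound)
    set η := min δ ε with hη
    have hηpos : 0 < η := lt_min hδ hε
    have hFδ : ∀ᶠ p in 𝓝 (0 : E × E), ‖F p‖ < δ :=
      (hcF.eventually (Metric.ball_mem_nhds (0 : E) hδ)).mono fun p hp => by simpa using hp
    filter_upwards [hFδ, Metric.ball_mem_nhds (0 : E × E) hηpos] with p hp1 hp2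
    obtain ⟨x, y⟩ := p
    have hxy : ‖x‖ < η ∧ ‖y‖ < η := by
      simpa [Prod.norm_def] using hp2
    have hx := hL x (hxy.1.trans_le (min_le_left _ _))
    have hy := hL y (hxy.2.trans_le (min_le_left _ _))
    have hz := hL _ hp1
    have hsm : ∀ k, ‖(r^[k] x, r^[k] y)‖ ≤ (2 / 3 : ℝ) ^ k * η := by
      intro k
      rw [Prod.norm_def]
      refine max_le ((hx.1 k).trans ?_) ((hy.1 k).trans ?_)
      · gcongr; exact hxy.1.le
      · gcongr; exact hxy.2.le
    have hsm' : ∀ k, (r^[k] x, r^[k] y) ∈ Metric.ball (0 : E × E) ε := by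
      intro k
      have h1 : ‖(r^[k] x, r^[k] y)‖ < η := by
        rw [Prod.norm_def]
        refine max_lt (((hx.1 k).trans ?_).trans_lt hxy.1) (((hy.1 k).trans ?_).trans_lt hxy.2) <;>
        exact mul_le_of_le_one_left (norm_nonneg _) (pow_le_one₀ (by norm_num) (by norm_num))
      rw [mem_ball_zero_iff]
      exact h1.trans_le (min_le_right _ _)
    have hit : ∀ k, r^[k] (F (x, y)) = F (r^[k] x, r^[k] y) := by
      intro k
      induction k with
      | zero => rfl
      | succ k ih =>
        rw [Function.iterate_succ_apply', ih, (hball _ (hsm' k)).1,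
          Function.iterate_succ_apply', Function.iterate_succ_apply']
    -- To first order `F` is addition. The second-order error at the `k`-th roots is of size `(2/3)
    -- ^ (2k)`, so it vanishes in the limit even after multiplication by `2 ^ k`.
    have hlim : Tendsto (fun k => (2 : ℂ) ^ k • r^[k] (F (x, y)) -
        ((2 : ℂ) ^ k • r^[k] x + (2 : ℂ) ^ k • r^[k] y)) atTop (𝓝 0) := by
      refine squeeze_zero_norm (a := fun k => K * η ^ 2 * (8 / 9 : ℝ) ^ k) (fun k => ?_) ?_
      · rw [← smul_add, ← smul_sub, norm_smul, hit]
        have h1 := (hball _ (hsm' k)).2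
        rw [hF0] at h1
        simp only [sub_zero, _root_.add_apply, ContinuousLinearMap.coe_fst',
          ContinuousLinearMap.coe_snd', norm_pow, norm_norm] at h1
        have h3 : ‖(2 : ℂ) ^ k‖ = 2 ^ k := by simp
        rw [h3]
        calc (2 : ℝ) ^ k * ‖F (r^[k] x, r^[k] y) - (r^[k] x + r^[k] y)‖
            ≤ 2 ^ k * (K * ‖(r^[k] x, r^[k] y)‖ ^ 2) := by gcongr
          _ ≤ 2 ^ k * (K * ((2 / 3 : ℝ) ^ k * η) ^ 2) := by gcongr; exact hsm k
          _ = K * η ^ 2 * (8 / 9 : ℝ) ^ k := by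
            have : (8 / 9 : ℝ) ^ k = 2 ^ k * ((2 / 3 : ℝ) ^ k) ^ 2 := by
              rw [← pow_mul, mul_comm k 2, pow_mul, ← mul_pow]; norm_num
            rw [this]; ring
      · simpa using (tendsto_pow_atTop_nhds_zero_of_lt_one (by norm_num : (0 : ℝ) ≤ 8 / 9)
          (by norm_num)).const_mul (K * η ^ 2)
    have := tendsto_nhds_unique hlim (hz.2.1.sub (hx.2.1.add hy.2.1))
    exact (sub_eq_zero.1 this.symm)
  refine ⟨L, ?_, hL0, hLlin, hadd⟩
  -- the derivative of `L` is analytic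
  have hD' : AnalyticAt ℂ (fun x : E => (fderiv ℂ D (x, x)).comp (ContinuousLinearMap.inr ℂ E E))
      0 := by
    have h1 : AnalyticAt ℂ (fun x : E => fderiv ℂ D (x, x)) 0 := hD.fderiv.comp_of_eq hdiag rfl
    exact ((ContinuousLinearMap.compL ℂ E (E × E) E).flip
      (ContinuousLinearMap.inr ℂ E E)).analyticAt _ |>.comp h1
  refine analyticAt_of_hasFDerivAt ?_ hD'
  have hdt : Tendsto (fun x : E => (x, x)) (𝓝 0) (𝓝 (0 : E × E)) := hdiag.continuousAt.tendsto
  have hDtend : Tendsto (fun p : E × E => (p.1, D p)) (𝓝 0) (𝓝 0) := by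
    have h1 : Tendsto D (𝓝 0) (𝓝 0) := by simpa [hD0] using hD.continuousAt.tendsto
    have hf1 : Tendsto Prod.fst (𝓝 (0 : E × E)) (𝓝 0) := continuous_fst.tendsto 0
    rw [show (0 : E × E) = (0, 0) from rfl] at *
    exact hf1.prodMk_nhds h1
  -- So far `L` is known to be differentiable only at `0`. Writing a nearby point `z` as `x` times
  -- the quotient `D (x, z)`, with `D (x, x) = 0`, carries this derivative to `x`, where it becomes
  -- a partial derivative of `D`, analytic in `x`.
  have hrel : ∀ᶠ p in 𝓝 (0 : E × E), L p.2 = L p.1 + L (D p) := by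
    filter_upwards [hDtend.eventually hadd, hDF] with p h1 h2
    rw [← h1, h2]
  filter_upwards [hdt.eventually hrel.eventually_nhds,
    hdt.eventually hD.eventually_analyticAt, hDdiag] with x h1 h2 h3
  have h4 : HasFDerivAt (fun z => D (x, z))
      ((fderiv ℂ D (x, x)).comp (ContinuousLinearMap.inr ℂ E E)) x :=
    HasFDerivAt.comp x (f := fun z : E => (x, z)) h2.differentiableAt.hasFDerivAt
      (hasFDerivAt_prodMk_right x x)
  have h5 : HasFDerivAt (fun z => L x + L (D (x, z)))
      ((ContinuousLinearMap.id ℂ E).comp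
        ((fderiv ℂ D (x, x)).comp (ContinuousLinearMap.inr ℂ E E))) x := by
    refine HasFDerivAt.const_add _ (HasFDerivAt.comp x (g := L) ?_ h4)
    rw [h3]; exact hLlin
  refine h5.congr_of_eventuallyEq ?_
  have h6 : Tendsto (fun z : E => (x, z)) (𝓝 x) (𝓝 (x, x)) := by
    exact (Continuous.prodMk_right x).tendsto x
  exact h6.eventually h1

/-! ### The global holomorphic exponential map -/

/-- A local homomorphism from a normed space to a commutative group extends to a homomorphism. -/
theorem exists_hom_eventuallyEq_of_local_hom {V A : Type*} [NormedAddCommGroup V]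
    [NormedSpace ℝ V] [CommGroup A] {f : V → A}
    (hf : ∀ᶠ p in 𝓝 (0 : V × V), f (p.1 + p.2) = f p.1 * f p.2) :
    ∃ e : V → A, (∀ v w, e (v + w) = e v * e w) ∧ e =ᶠ[𝓝 0] f := by
  obtain ⟨δ, hδ, hball⟩ := Metric.eventually_nhds_iff_ball.1 hf
  have hadd : ∀ v w : V, ‖v‖ < δ → ‖w‖ < δ → f (v + w) = f v * f w := by
    intro v w hv hw
    exact hball (v, w) (by simpa [Prod.norm_def] using ⟨hv, hw⟩)
  -- Halve the argument until `f` is multiplicative there, then undo the halvings by squaring in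
  -- `A`. Once the argument is small, a further halving does not change the value.
  let g : ℕ → V → A := fun k v => f (((1 / 2 : ℝ) ^ k) • v) ^ (2 ^ k)
  have hhalf : ∀ (k : ℕ) (v : V), ‖((1 / 2 : ℝ) ^ k) • v‖ = (1 / 2 : ℝ) ^ k * ‖v‖ := by
    intro k v
    rw [norm_smul, norm_pow]
    norm_num
  have hsucc : ∀ k v, ‖((1 / 2 : ℝ) ^ k) • v‖ < δ → g (k + 1) v = g k v := by
    intro k v hv
    have h1 : ‖((1 / 2 : ℝ) ^ (k + 1)) • v‖ < δ := by
      rw [hhalf] at hv ⊢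
      refine lt_of_le_of_lt ?_ hv
      rw [pow_succ]
      have : 0 ≤ (1 / 2 : ℝ) ^ k * ‖v‖ := by positivity
      linarith
    have h2 : ((1 / 2 : ℝ) ^ k) • v = ((1 / 2 : ℝ) ^ (k + 1)) • v + ((1 / 2 : ℝ) ^ (k + 1)) • v := by
      rw [← add_smul]; congr 1; rw [pow_succ]; ring
    simp only [g]
    rw [h2, hadd _ _ h1 h1, ← sq, ← pow_mul, pow_succ' 2 k]
  have hstable : ∀ k v, ‖((1 / 2 : ℝ) ^ k) • v‖ < δ → ∀ j, k ≤ j → g j v = g k v := by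
    intro k v hv j hj
    induction j, hj using Nat.le_induction with
    | base => rfl
    | succ j hj ih =>
      rw [← ih]
      refine hsucc j v (lt_of_le_of_lt ?_ hv)
      rw [hhalf, hhalf]
      gcongr ?_ * _
      exact pow_le_pow_of_le_one (by norm_num) (by norm_num) hj
  have hex : ∀ v : V, ∃ k : ℕ, ‖((1 / 2 : ℝ) ^ k) • v‖ < δ := by
    intro v
    have h1 : Tendsto (fun k : ℕ => (1 / 2 : ℝ) ^ k * ‖v‖) atTop (𝓝 0) := by
      simpa using (tendsto_pow_atTop_nhds_zero_of_lt_one (by norm_num : (0 : ℝ) ≤ 1 / 2)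
        (by norm_num)).mul_const ‖v‖
    obtain ⟨k, hk⟩ := (h1.eventually_lt_const hδ).exists
    exact ⟨k, by rwa [hhalf]⟩
  choose N hN using hex
  refine ⟨fun v => g (N v) v, fun v w => ?_, ?_⟩
  -- At a common stage `j` all three arguments are in the ball where `f` is additive.
  · set j := max (N (v + w)) (max (N v) (N w)) with hj
    have hle : ∀ (k : ℕ) (u : V), ‖((1 / 2 : ℝ) ^ k) • u‖ < δ → k ≤ j →
        ‖((1 / 2 : ℝ) ^ j) • u‖ < δ := by
      intro k u hu hk
      refine lt_of_le_of_lt ?_ hu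
      rw [hhalf, hhalf]
      gcongr ?_ * _
      exact pow_le_pow_of_le_one (by norm_num) (by norm_num) hk
    have h1 : N (v + w) ≤ j := le_max_left _ _
    have h2 : N v ≤ j := (le_max_left _ _).trans (le_max_right _ _)
    have h3 : N w ≤ j := (le_max_right _ _).trans (le_max_right _ _)
    simp only
    rw [← hstable _ _ (hN (v + w)) j h1, ← hstable _ _ (hN v) j h2, ← hstable _ _ (hN w) j h3]
    simp only [g]
    rw [smul_add, hadd _ _ (hle _ _ (hN v) h2) (hle _ _ (hN w) h3), mul_pow]
  · filter_upwards [Metric.ball_mem_nhds (0 : V) hδ] with v hv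
    have h1 := hstable 0 v (by simpa using hv) (N v) (Nat.zero_le _)
    simpa [g] using h1

/-- A holomorphic exponential map `e` of a commutative complex Lie group. -/
structure IsHolExp {V E A : Type*} [NormedAddCommGroup V] [NormedSpace ℂ V]
    [NormedAddCommGroup E] [NormedSpace ℂ E] [CommGroup A] [TopologicalSpace A]
    [ChartedSpace E A] (e : V → A) : Prop where
  map_add : ∀ v w, e (v + w) = e v * e w
  contMDiff : ContMDiff 𝓘(ℂ, V) 𝓘(ℂ, E) ω e
  exists_log : ∃ l : A → V, ContMDiffAt 𝓘(ℂ, E) 𝓘(ℂ, V) ω l 1 ∧ l 1 = 0 ∧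
    (∀ᶠ x in 𝓝 1, e (l x) = x) ∧ ∀ᶠ v in 𝓝 0, l (e v) = v

/-- In a chart centred at `1`, commutativity makes the multiplication `F` satisfy the medial law, so
a local logarithm `L` exists. Its inverse `M` followed by the inverse chart is a local homomorphism,
and this extends by doubling. The extension is holomorphic near `0`, hence everywhere by
translation. -/
theorem LieGroup.exists_isHolExp (E A : Type*) [NormedAddCommGroup E] [NormedSpace ℂ E]
    [CompleteSpace E] [CommGroup A] [TopologicalSpace A] [ChartedSpace E A]
    [LieGroup 𝓘(ℂ, E) ω A] : ∃ e : E → A, IsHolExp (E := E) e := by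
  have : IsTopologicalGroup A := topologicalGroup_of_lieGroup 𝓘(ℂ, E) ω
  let φ := chartAt E (1 : A)
  let c := φ 1
  let ψ : E → A := fun v => φ.symm (v + c)
  let l : A → E := fun x => φ x - c
  have hc : c ∈ φ.target := mem_chart_target E (1 : A)
  have h1s : (1 : A) ∈ φ.source := mem_chart_source E (1 : A)
  have hψ0 : ψ 0 = 1 := by simp [ψ, c, φ.left_inv h1s]
  have hl1 : l 1 = 0 := sub_self _
  have hlψ : ∀ᶠ v in 𝓝 0, l (ψ v) = v := by
    have : Tendsto (fun v : E => v + c) (𝓝 0) (𝓝 c) := by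
      simpa using (continuous_add_const c).tendsto 0
    filter_upwards [this.eventually (φ.open_target.mem_nhds hc)] with v hv
    simp [l, ψ, φ.right_inv hv]
  have hψl : ∀ᶠ x in 𝓝 1, ψ (l x) = x := by
    filter_upwards [φ.open_source.mem_nhds h1s] with x hx
    simp [l, ψ, φ.left_inv hx]
  have hlm : ContMDiffAt 𝓘(ℂ, E) 𝓘(ℂ, E) ω l 1 := by
    refine ContMDiffAt.sub ?_ contMDiffAt_const
    exact contMDiffAt_of_mem_maximalAtlas (IsManifold.chart_mem_maximalAtlas _) h1s
  have hψm : ContMDiffAt 𝓘(ℂ, E) 𝓘(ℂ, E) ω ψ 0 := by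
    have h1 : ContMDiffAt 𝓘(ℂ, E) 𝓘(ℂ, E) ω φ.symm (0 + c) :=
      contMDiffAt_symm_of_mem_maximalAtlas (IsManifold.chart_mem_maximalAtlas _) (by simpa using hc)
    exact ContMDiffAt.comp (0 : E) (f := fun v : E => v + c) h1
      (contDiff_id.add contDiff_const).contMDiff.contMDiffAt
  have hψt : Tendsto ψ (𝓝 0) (𝓝 1) := by simpa [hψ0] using hψm.continuousAt.tendsto
  have hlt : Tendsto l (𝓝 1) (𝓝 0) := by simpa [hl1] using hlm.continuousAt.tendsto
  have hfst : Tendsto Prod.fst (𝓝 (0 : E × E)) (𝓝 0) := continuous_fst.tendsto 0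
  have hsnd : Tendsto Prod.snd (𝓝 (0 : E × E)) (𝓝 0) := continuous_snd.tendsto 0
  have hψ1 : ContMDiffAt 𝓘(ℂ, E × E) 𝓘(ℂ, E) ω (fun p : E × E => ψ p.1) 0 :=
    ContMDiffAt.comp (0 : E × E) (f := Prod.fst) hψm contDiff_fst.contMDiff.contMDiffAt
  have hψ2 : ContMDiffAt 𝓘(ℂ, E × E) 𝓘(ℂ, E) ω (fun p : E × E => ψ p.2) 0 :=
    ContMDiffAt.comp (0 : E × E) (f := Prod.snd) hψm contDiff_snd.contMDiff.contMDiffAt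
  let F : E × E → E := fun p => l (ψ p.1 * ψ p.2)
  let D : E × E → E := fun p => l ((ψ p.1)⁻¹ * ψ p.2)
  have hF : AnalyticAt ℂ F 0 := by
    refine (contMDiffAt_iff_contDiffAt.1 ?_).analyticAt
    refine ContMDiffAt.comp (0 : E × E) (g := l) ?_ (hψ1.mul hψ2)
    simpa [hψ0] using hlm
  have hD : AnalyticAt ℂ D 0 := by
    refine (contMDiffAt_iff_contDiffAt.1 ?_).analyticAt
    refine ContMDiffAt.comp (0 : E × E) (g := l) ?_ (hψ1.inv.mul hψ2)
    simpa [hψ0] using hlm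
  have hF0 : F 0 = 0 := by simp [F, hψ0, hl1]
  have hFt : Tendsto F (𝓝 0) (𝓝 0) := by simpa [hF0] using hF.continuousAt.tendsto
  have hψF : ∀ᶠ p in 𝓝 (0 : E × E), ψ (F p) = ψ p.1 * ψ p.2 := by
    have : Tendsto (fun p : E × E => ψ p.1 * ψ p.2) (𝓝 0) (𝓝 1) := by
      simpa using (hψt.comp hfst).mul (hψt.comp hsnd)
    exact this.eventually hψl
  have hψD : ∀ᶠ p in 𝓝 (0 : E × E), ψ (D p) = (ψ p.1)⁻¹ * ψ p.2 := by
    have : Tendsto (fun p : E × E => (ψ p.1)⁻¹ * ψ p.2) (𝓝 0) (𝓝 1) := by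
      simpa using (hψt.comp hfst).inv.mul (hψt.comp hsnd)
    exact this.eventually hψl
  have hdiag : Tendsto (fun x : E => (x, x)) (𝓝 0) (𝓝 (0 : E × E)) :=
    (continuous_id.prodMk continuous_id).tendsto (0 : E)
  obtain ⟨L, hL, hL0, hL', hLF⟩ := AnalyticAt.exists_local_log (F := F) (D := D) hF
    (by filter_upwards [hlψ] with x hx; simp [F, hψ0, hx])
    (by filter_upwards [hlψ] with x hx; simp [F, hψ0, hx])
    (by
      filter_upwards [hψF, (hdiag.comp hfst).eventually hψF, (hdiag.comp hsnd).eventually hψF]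
        with p h1 h2 h3
      simp only [Function.comp] at h2 h3
      change l (ψ (F p) * ψ (F p)) = l (ψ (F (p.1, p.1)) * ψ (F (p.2, p.2)))
      rw [h1, h2, h3, mul_mul_mul_comm])
    hD
    (by filter_upwards with x; simp [D, hl1])
    (by
      filter_upwards [hψD, hsnd.eventually hlψ] with p h1 h2
      change l (ψ p.1 * ψ (D p)) = p.2
      rw [h1, mul_inv_cancel_left, h2])
  obtain ⟨M, hM, hM0, -, hLM, hML⟩ := hL.exists_local_inverse hL0
    (e := ContinuousLinearEquiv.refl ℂ E) hL'
  have hMt : Tendsto M (𝓝 0) (𝓝 0) := by simpa [hM0] using hM.continuousAt.tendsto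
  have hMM : Tendsto (fun p : E × E => (M p.1, M p.2)) (𝓝 0) (𝓝 0) :=
    (hMt.prodMap hMt).mono_left nhds_prod_eq.le |>.mono_right nhds_prod_eq.ge
  have hloc : ∀ᶠ p in 𝓝 (0 : E × E), ψ (M (p.1 + p.2)) = ψ (M p.1) * ψ (M p.2) := by
    filter_upwards [hMM.eventually hLF, hMM.eventually hψF, (hFt.comp hMM).eventually hML,
      hfst.eventually hLM, hsnd.eventually hLM] with p h1 h2 h3 h4 h5
    simp only [Function.comp] at h3
    rw [h1, h4, h5] at h3
    rw [h3, h2]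
  let : NormedSpace ℝ E := NormedSpace.restrictScalars ℝ ℂ E
  obtain ⟨e, hadd, he⟩ := exists_hom_eventuallyEq_of_local_hom (f := fun v => ψ (M v)) hloc
  have he0 : ContMDiffAt 𝓘(ℂ, E) 𝓘(ℂ, E) ω e 0 := by
    refine ContMDiffAt.congr_of_eventuallyEq ?_ he
    refine ContMDiffAt.comp (0 : E) (g := ψ) ?_ hM.contDiffAt.contMDiffAt
    rw [hM0]; exact hψm
  refine ⟨e, hadd, fun v => ?_, fun x => L (l x), ?_, ?_, ?_, ?_⟩
  · have h1 : e = fun w => e v * e (w - v) := by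
      funext w
      rw [← hadd]; simp
    rw [h1]
    refine contMDiffAt_const.mul ?_
    refine ContMDiffAt.comp v (g := e) ?_ (contDiff_id.sub contDiff_const).contMDiff.contMDiffAt
    simpa using he0
  · refine ContMDiffAt.comp (1 : A) (g := L) ?_ hlm
    rw [hl1]
    exact hL.contDiffAt.contMDiffAt
  · change L (l 1) = 0
    rw [hl1, hL0]
  · have hLt : Tendsto L (𝓝 0) (𝓝 0) := by simpa [hL0] using hL.continuousAt.tendsto
    filter_upwards [(hLt.comp hlt).eventually he, hlt.eventually hML, hψl] with x h1 h2 h3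
    simp only [Function.comp] at h1
    rw [h1, h2, h3]
  · filter_upwards [he, hMt.eventually hlψ, hLM] with v h1 h2 h3
    rw [h1, h2, h3]

/-! ### Lie group structures built from exponential maps -/

/-- A homomorphism `e` from a normed space to a topological group that is a local homeomorphism. -/
structure IsExp {V A : Type*} [NormedAddCommGroup V] [CommGroup A] [TopologicalSpace A]
    (e : V → A) : Prop where
  map_add : ∀ v w, e (v + w) = e v * e w
  map_nhds : map e (𝓝 0) = 𝓝 1
  locally_injective : ∀ᶠ v in 𝓝 0, e v = 1 → v = 0

namespace IsExp

section

variable {V A : Type*} [NormedAddCommGroup V] [CommGroup A] [TopologicalSpace A] {e : V → A}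

theorem map_zero (h : IsExp e) : e 0 = 1 := by
  have := h.map_add 0 0
  simpa using this

theorem map_neg (h : IsExp e) (v : V) : e (-v) = (e v)⁻¹ := by
  rw [eq_inv_iff_mul_eq_one, ← h.map_add, neg_add_cancel, h.map_zero]

theorem map_sub (h : IsExp e) (v w : V) : e (v - w) = e v / e w := by
  rw [sub_eq_add_neg, h.map_add, h.map_neg, div_eq_mul_inv]

theorem tendsto_zero (h : IsExp e) : Tendsto e (𝓝 0) (𝓝 1) := h.map_nhds.le

/-- The difference of the two increments tends to `0` and lies in the kernel of `e`, so it vanishes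
near `x` by local injectivity. This is what makes coordinate changes locally translations. -/
theorem eventually_eq_add_of_tendsto (h : IsExp e) {X : Type*} [TopologicalSpace X] {x : X}
    {f g : X → V} (hf : ContinuousAt f x) (hg : ContinuousAt g x)
    (hfg : ∀ᶠ y in 𝓝 x, e (f y - f x) = e (g y - g x)) :
    ∀ᶠ y in 𝓝 x, f y = f x + (g y - g x) := by
  have h1 : Tendsto (fun y => (f y - f x) - (g y - g x)) (𝓝 x) (𝓝 0) := by
    have := (hf.tendsto.sub_const (f x)).sub (hg.tendsto.sub_const (g x))
    simpa using this
  filter_upwards [h1.eventually h.locally_injective, hfg] with y h2 h3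
  have := h2 (by rw [h.map_sub, h3, div_self'])
  rw [sub_eq_zero] at this
  rw [← this]; abel

theorem exists_injOn (h : IsExp e) : ∃ δ > 0, Set.InjOn e (Metric.ball 0 δ) := by
  obtain ⟨δ, hδ, hball⟩ := Metric.eventually_nhds_iff_ball.1 h.locally_injective
  -- The difference of two points in the ball of radius `δ / 2` has norm below `δ`.
  refine ⟨δ / 2, half_pos hδ, fun v hv w hw hvw => ?_⟩
  have h1 : e (v - w) = 1 := by rw [h.map_sub, hvw, div_self']
  refine sub_eq_zero.1 (hball _ ?_ h1)
  rw [mem_ball_zero_iff] at *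
  exact (norm_sub_le _ _).trans_lt (by linarith)

/-- The radius of a ball on which the exponential map is injective. -/
noncomputable def radius (h : IsExp e) : ℝ := h.exists_injOn.choose

theorem radius_pos (h : IsExp e) : 0 < h.radius := h.exists_injOn.choose_spec.1

theorem injOn (h : IsExp e) : Set.InjOn e (Metric.ball 0 h.radius) := h.exists_injOn.choose_spec.2

variable [IsTopologicalGroup A]

theorem continuous (h : IsExp e) : Continuous e := by
  refine continuous_iff_continuousAt.2 fun v => ?_
  have h1 : e = fun w => e v * e (w - v) := by
    funext w
    rw [← h.map_add]; simp
  have h2 : Tendsto (fun w => w - v) (𝓝 v) (𝓝 0) := by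
    simpa using (continuous_sub_right v).tendsto v
  rw [h1]
  have h3 := (h.tendsto_zero.comp h2).const_mul (e v)
  have h4 : e v * e (v - v) = e v * 1 := by rw [sub_self, h.map_zero]
  rw [ContinuousAt, h4]
  exact h3

theorem isOpenMap (h : IsExp e) : IsOpenMap e := by
  refine IsOpenMap.of_nhds_le fun v => ?_
  have h1 : 𝓝 (e v) = map (fun x => e v * x) (𝓝 1) := by
    simp
  have h2 : 𝓝 v = map (fun w => v + w) (𝓝 0) := by
    simp
  rw [h1, h2, ← h.map_nhds, map_map, map_map]
  exact le_of_eq (by congr 1; funext w; simp [h.map_add])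

/-- The exponential map, restricted to a ball. -/
noncomputable def localHomeo (h : IsExp e) : OpenPartialHomeomorph V A :=
  OpenPartialHomeomorph.ofContinuousOpen (h.injOn.toPartialEquiv e (Metric.ball 0 h.radius))
    h.continuous.continuousOn h.isOpenMap Metric.isOpen_ball

theorem localHomeo_source (h : IsExp e) : h.localHomeo.source = Metric.ball 0 h.radius := rfl

theorem zero_mem_source (h : IsExp e) : (0 : V) ∈ h.localHomeo.source := by
  rw [h.localHomeo_source]
  exact Metric.mem_ball_self h.radius_pos

/-- The chart around `a` given by the exponential map. -/
noncomputable def chart (h : IsExp e) (a : A) : OpenPartialHomeomorph A V :=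
  (Homeomorph.mulLeft a⁻¹).transOpenPartialHomeomorph h.localHomeo.symm

theorem chart_apply (h : IsExp e) (a x : A) : h.chart a x = h.localHomeo.symm (a⁻¹ * x) := rfl

theorem chart_symm_apply (h : IsExp e) (a : A) (v : V) : (h.chart a).symm v = a * e v := by
  change (Homeomorph.mulLeft a⁻¹).symm (h.localHomeo v) = _
  rw [Homeomorph.mulLeft_symm, inv_inv]
  rfl

theorem mem_chart_source (h : IsExp e) (a : A) : a ∈ (h.chart a).source := by
  change a⁻¹ * a ∈ h.localHomeo.symm.source
  rw [inv_mul_cancel, ← h.map_zero]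
  exact h.localHomeo.map_source h.zero_mem_source

theorem chart_self (h : IsExp e) (a : A) : h.chart a a = 0 := by
  rw [chart_apply, inv_mul_cancel, ← h.map_zero]
  exact h.localHomeo.left_inv h.zero_mem_source

theorem mul_exp_chart (h : IsExp e) {a x : A} (hx : x ∈ (h.chart a).source) :
    a * e (h.chart a x) = x := by
  rw [← h.chart_symm_apply, (h.chart a).left_inv hx]

theorem eventually_eq_mul_exp (h : IsExp e) (a : A) :
    ∀ᶠ x in 𝓝 a, x = a * e (h.chart a x) := by
  filter_upwards [(h.chart a).open_source.mem_nhds (h.mem_chart_source a)] with x hx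
  exact (h.mul_exp_chart hx).symm

/-- The charts given by an exponential map. -/
@[reducible]
noncomputable def chartedSpace (h : IsExp e) : ChartedSpace V A where
  atlas := Set.range h.chart
  chartAt := h.chart
  mem_chart_source := h.mem_chart_source
  chart_mem_atlas a := Set.mem_range_self a

end

section

variable {V A : Type*} [NormedAddCommGroup V] [NormedSpace ℂ V] [CommGroup A] [TopologicalSpace A]
  [IsTopologicalGroup A] {e : V → A}

/-- Two charts at the same point are logarithms up to left translation, so a transition map differs
from the identity by a locally constant vector. -/
theorem isManifold (h : IsExp e) :
    letI := h.chartedSpace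
    IsManifold 𝓘(ℂ, V) ω A := by
  let := h.chartedSpace
  refine isManifold_of_contDiffOn _ _ _ ?_
  rintro _ _ ⟨a, rfl⟩ ⟨b, rfl⟩
  simp only [modelWithCornersSelf_coe, modelWithCornersSelf_coe_symm, Set.range_id, Set.inter_univ,
    Set.preimage_id, Function.id_comp, Function.comp_id]
  intro v hv
  refine ContDiffAt.contDiffWithinAt ?_
  have hopen := ((h.chart a).symm.trans (h.chart b)).open_source
  set T := (h.chart a).symm.trans (h.chart b) with hT
  have hTe : ∀ w ∈ T.source, b * e (T w) = a * e w := by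
    intro w hw
    rw [← h.chart_symm_apply a w]
    exact h.mul_exp_chart hw.2
  have key : ∀ᶠ w in 𝓝 v, T w = T v + (w - v) := by
    refine h.eventually_eq_add_of_tendsto (f := T) (g := id) (T.continuousAt hv) continuousAt_id ?_
    filter_upwards [hopen.mem_nhds hv] with w hw
    have h1 := hTe w hw
    have h2 := hTe v hv
    rw [h.map_sub, h.map_sub, id, id, ← mul_div_mul_left_eq_div _ _ b, h1, h2,
      mul_div_mul_left_eq_div]
  exact ContDiffAt.congr_of_eventuallyEq
    (contDiffAt_const.add (contDiffAt_id.sub contDiffAt_const)) key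

/-- In the chart centred at `f t` the map reads `g s - g t`. Thus holomorphy into the group only
requires a holomorphic local lift through `e`. -/
theorem contMDiffAt_of_eventuallyEq (h : IsExp e) {E H M : Type*} [NormedAddCommGroup E]
    [NormedSpace ℂ E] [TopologicalSpace H] {I : ModelWithCorners ℂ E H} [TopologicalSpace M]
    [ChartedSpace H M] {f : M → A} {a : A} {g : M → V} {t : M}
    (hg : ContMDiffAt I 𝓘(ℂ, V) ω g t) (hfg : ∀ᶠ s in 𝓝 t, f s = a * e (g s)) :
    letI := h.chartedSpace
    ContMDiffAt I 𝓘(ℂ, V) ω f t := by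
  let := h.chartedSpace
  have hft : f t = a * e (g t) := hfg.self_of_nhds
  rw [contMDiffAt_iff_target]
  constructor
  · have h1 : ContinuousAt (fun s => a * e (g s)) t :=
      (h.continuous.continuousAt.comp hg.continuousAt).const_mul a
    exact h1.congr_of_eventuallyEq hfg
  · have h1 : ContMDiffAt I 𝓘(ℂ, V) ω (fun s => g s - g t) t := hg.sub contMDiffAt_const
    refine h1.congr_of_eventuallyEq ?_
    have h2 : Tendsto (fun s => g s - g t) (𝓝 t) (𝓝 0) := by
      simpa using h1.continuousAt.tendsto
    filter_upwards [hfg, h2.eventually (h.localHomeo.open_source.mem_nhds h.zero_mem_source)]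
      with s h3 h4
    change h.chart (f t) (f s) = _
    rw [h.chart_apply, h3, hft]
    have h5 : (a * e (g t))⁻¹ * (a * e (g s)) = e (g s - g t) := by
      rw [h.map_sub, mul_inv_rev, div_eq_mul_inv]
      group
      rw [mul_comm]
    rw [h5]
    exact h.localHomeo.left_inv h4

theorem contMDiffAt_chart (h : IsExp e) (a : A) :
    letI := h.chartedSpace
    ContMDiffAt 𝓘(ℂ, V) 𝓘(ℂ, V) ω (h.chart a) a := by
  let := h.chartedSpace
  have := h.isManifold
  exact contMDiffAt_extChartAt (x := a)

/-- In exponential coordinates multiplication is addition and inversion is negation. -/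
theorem lieGroup (h : IsExp e) :
    letI := h.chartedSpace
    LieGroup 𝓘(ℂ, V) ω A := by
  let := h.chartedSpace
  have := h.isManifold
  refine { contMDiff_mul := ?_, contMDiff_inv := ?_ }
  · rintro ⟨a, b⟩
    refine h.contMDiffAt_of_eventuallyEq (a := a * b)
      (g := fun p : A × A => h.chart a p.1 + h.chart b p.2) ?_ ?_
    · refine ContMDiffAt.add ?_ ?_
      · exact ContMDiffAt.comp (a, b) (g := h.chart a) (f := Prod.fst) (h.contMDiffAt_chart a)
          contMDiffAt_fst
      · exact ContMDiffAt.comp (a, b) (g := h.chart b) (f := Prod.snd) (h.contMDiffAt_chart b)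
          contMDiffAt_snd
    · have h1 := (continuous_fst.tendsto (a, b)).eventually (h.eventually_eq_mul_exp a)
      have h2 := (continuous_snd.tendsto (a, b)).eventually (h.eventually_eq_mul_exp b)
      filter_upwards [h1, h2] with p h3 h4
      rw [h.map_add, mul_mul_mul_comm, ← h3, ← h4]
  · intro a
    refine h.contMDiffAt_of_eventuallyEq (a := a⁻¹) (g := fun x : A => -h.chart a x)
      (h.contMDiffAt_chart a).neg ?_
    filter_upwards [h.eventually_eq_mul_exp a] with x hx
    conv_lhs => rw [hx]
    rw [h.map_neg, mul_inv]

theorem isHolExp (h : IsExp e) :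
    letI := h.chartedSpace
    IsHolExp (E := V) e := by
  let := h.chartedSpace
  refine ⟨h.map_add, fun v => ?_, h.chart 1, h.contMDiffAt_chart 1, h.chart_self 1, ?_, ?_⟩
  · exact h.contMDiffAt_of_eventuallyEq (a := 1) (g := id) contMDiffAt_id (by simp)
  · filter_upwards [h.eventually_eq_mul_exp 1] with x hx
    rw [one_mul] at hx
    exact hx.symm
  · filter_upwards [h.localHomeo.open_source.mem_nhds h.zero_mem_source] with v hv
    rw [h.chart_apply, inv_one, one_mul]
    exact h.localHomeo.left_inv hv

end

end IsExp

namespace IsHolExp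

variable {V E A : Type*} [NormedAddCommGroup V] [NormedSpace ℂ V]
    [NormedAddCommGroup E] [NormedSpace ℂ E] [CommGroup A] [TopologicalSpace A]
    [ChartedSpace E A] {e : V → A}

theorem isExp (h : IsHolExp (E := E) e) : IsExp e := by
  obtain ⟨l, hl, hl1, hel, hle⟩ := h.exists_log
  have h0 : e 0 = 1 := by simpa using h.map_add 0 0
  refine ⟨h.map_add, ?_, ?_⟩
  · refine le_antisymm ?_ ?_
    · have h1 := h.contMDiff.continuous.tendsto 0
      rwa [h0] at h1
    · have h2 : Tendsto l (𝓝 1) (𝓝 0) := by simpa [hl1] using hl.continuousAt.tendsto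
      calc 𝓝 (1 : A) = map id (𝓝 1) := map_id.symm
        _ = map (e ∘ l) (𝓝 1) := (map_congr (hel.mono fun x hx => hx)).symm
        _ = map e (map l (𝓝 1)) := map_map.symm
        _ ≤ map e (𝓝 0) := map_mono h2
  · filter_upwards [hle] with v hv hv1
    rw [← hv, hv1, hl1]

theorem contMDiffAt_iff [LieGroup 𝓘(ℂ, E) ω A] (h : IsHolExp (E := E) e) {E' H M : Type*}
    [NormedAddCommGroup E']
    [NormedSpace ℂ E'] [TopologicalSpace H] {I : ModelWithCorners ℂ E' H} [TopologicalSpace M]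
    [ChartedSpace H M] {f : M → A} {t : M} :
    ContMDiffAt I 𝓘(ℂ, E) ω f t ↔ ∃ g : M → V, ContMDiffAt I 𝓘(ℂ, V) ω g t ∧ g t = 0 ∧
      ∀ᶠ s in 𝓝 t, f s = f t * e (g s) := by
  constructor
  · intro hf
    obtain ⟨l, hl, hl1, hel, hle⟩ := h.exists_log
    have h1 : ContMDiffAt I 𝓘(ℂ, E) ω (fun s => (f t)⁻¹ * f s) t := contMDiffAt_const.mul hf
    have h2 : Tendsto (fun s => (f t)⁻¹ * f s) (𝓝 t) (𝓝 1) := by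
      simpa using h1.continuousAt.tendsto
    refine ⟨fun s => l ((f t)⁻¹ * f s), ?_, by simp [hl1], ?_⟩
    · refine ContMDiffAt.comp t (g := l) ?_ h1
      rw [inv_mul_cancel]; exact hl
    · filter_upwards [h2.eventually hel] with s hs
      rw [hs, mul_inv_cancel_left]
  · rintro ⟨g, hg, -, hfg⟩
    refine ContMDiffAt.congr_of_eventuallyEq ?_ hfg
    exact contMDiffAt_const.mul (h.contMDiff.contMDiffAt.comp t hg)

end IsHolExp

/-! ### Separating characters: holomorphy tests and the Stein property -/

theorem contMDiffAt_units_iff {E H M : Type*} [NormedAddCommGroup E] [NormedSpace ℂ E]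
    [TopologicalSpace H] {I : ModelWithCorners ℂ E H} [TopologicalSpace M] [ChartedSpace H M]
    {f : M → ℂˣ} {t : M} :
    ContMDiffAt I 𝓘(ℂ, ℂ) ω f t ↔ ContMDiffAt I 𝓘(ℂ, ℂ) ω (fun s => (f s : ℂ)) t := by
  refine ⟨fun h => ContMDiffAt.comp t (g := Units.val) Units.contMDiff_val.contMDiffAt h,
    fun h => ?_⟩
  rw [contMDiffAt_iff_target]
  exact ⟨(Units.isOpenEmbedding_val.isEmbedding.continuousAt_iff).2 h.continuousAt, h⟩

theorem contMDiff_units_iff {E H M : Type*} [NormedAddCommGroup E] [NormedSpace ℂ E]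
    [TopologicalSpace H] {I : ModelWithCorners ℂ E H} [TopologicalSpace M] [ChartedSpace H M]
    {f : M → ℂˣ} :
    ContMDiff I 𝓘(ℂ, ℂ) ω f ↔ ContMDiff I 𝓘(ℂ, ℂ) ω (fun s => (f s : ℂ)) :=
  forall_congr' fun _ => contMDiffAt_units_iff

/-- A family of functionals without common zeros on `ℂ^n` contains a coordinate system. -/
theorem exists_coordinates_of_separating {n : ℕ} {ι : Type*} (ℓ : ι → (Fin n → ℂ) →L[ℂ] ℂ)
    (hℓ : ∀ v, (∀ i, ℓ i v = 0) → v = 0) :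
    ∃ (x : Fin n → ι) (T : (Fin n → ℂ) ≃L[ℂ] (Fin n → ℂ)), ∀ v j, T v j = ℓ (x j) v := by
  let V := Fin n → ℂ
  let ℓ' : ι → Module.Dual ℂ V := fun i => (ℓ i : V →ₗ[ℂ] ℂ)
  -- In finite dimension a space of functionals is determined by its common zeros, so the family
  -- spans the dual and contains a basis of it.
  have hspan : Submodule.span ℂ (Set.range ℓ') = ⊤ := by
    rw [← Subspace.dualCoannihilator_dualAnnihilator_eq (W := Submodule.span ℂ (Set.range ℓ'))]
    have : (Submodule.span ℂ (Set.range ℓ')).dualCoannihilator = ⊥ := by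
      rw [eq_bot_iff]
      intro v hv
      rw [Submodule.mem_dualCoannihilator] at hv
      exact hℓ v fun i => hv _ (Submodule.subset_span ⟨i, rfl⟩)
    rw [this, Submodule.dualAnnihilator_bot]
  obtain ⟨b, hb, hbs, hbl⟩ := exists_linearIndependent ℂ (Set.range ℓ')
  rw [hspan] at hbs
  let B : Module.Basis b ℂ (Module.Dual ℂ V) := Module.Basis.mk hbl (by simp [hbs])
  have : Fintype b := FiniteDimensional.fintypeBasisIndex B
  have hcard : Fintype.card b = n := by
    rw [← Module.finrank_eq_card_basis B, Subspace.dual_finrank_eq]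
    simp [V]
  let σ : Fin n ≃ b := (finCongr hcard.symm).trans (Fintype.equivFin b).symm
  have hx : ∀ j, ∃ i, ℓ' i = (σ j : Module.Dual ℂ V) := fun j => hb (σ j).2
  choose x hx using hx
  let T : V →ₗ[ℂ] (Fin n → ℂ) := LinearMap.pi fun j => ℓ' (x j)
  have hT : Function.Injective T := by
    rw [injective_iff_map_eq_zero]
    intro v hv
    refine hℓ v fun i => ?_
    have h1 : ∀ φ ∈ Submodule.span ℂ b, φ v = 0 := by
      intro φ hφ
      induction hφ using Submodule.span_induction with
      | mem φ hφ =>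
        have h2 : ℓ' (x (σ.symm ⟨φ, hφ⟩)) = φ := by rw [hx]; simp
        rw [← h2]
        exact congrFun hv _
      | zero => rfl
      | add φ ψ _ _ h1 h2 => simp [h1, h2]
      | smul c φ _ h1 => simp [h1]
    exact h1 (ℓ' i) (by rw [hbs]; trivial)
  refine ⟨x, (LinearEquiv.ofInjectiveEndo T hT).toContinuousLinearEquiv, fun v j => rfl⟩

/-- The characters `χ i` of `A` have the differentials `ℓ i` along `e`, and they separate points. -/
structure IsSeparatingFamily {V A ι : Type*} [NormedAddCommGroup V] [NormedSpace ℂ V]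
    [CommGroup A] (e : V → A) (χ : ι → A →* ℂˣ) (ℓ : ι → V →L[ℂ] ℂ) : Prop where
  apply_exp : ∀ i v, (χ i (e v) : ℂ) = Complex.exp (ℓ i v)
  separating : ∀ a, (∀ i, χ i a = 1) → a = 1

namespace IsSeparatingFamily

section

variable {V A ι : Type*} [NormedAddCommGroup V] [NormedSpace ℂ V]
    [CommGroup A] [TopologicalSpace A] {e : V → A} {χ : ι → A →* ℂˣ} {ℓ : ι → V →L[ℂ] ℂ}

/-- All characters are trivial on the image of the complex line through `v`, so this line lies in
the kernel of `e`; local injectivity at `0` excludes that unless `v = 0`. -/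
theorem eq_zero (hχ : IsSeparatingFamily e χ ℓ) (he : IsExp e) {v : V} (hv : ∀ i, ℓ i v = 0) :
    v = 0 := by
  have h1 : ∀ t : ℂ, e (t • v) = 1 := fun t => hχ.separating _ fun i => by
    ext
    simp [hχ.apply_exp, hv]
  have h2 : Tendsto (fun t : ℂ => t • v) (𝓝[≠] 0) (𝓝 0) := by
    have : Tendsto (fun t : ℂ => t • v) (𝓝 0) (𝓝 0) := by
      simpa using (continuous_id.smul continuous_const).tendsto (0 : ℂ) (f := fun t : ℂ => t • v)
    exact this.mono_left nhdsWithin_le_nhds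
  obtain ⟨t, ht, ht0⟩ := ((h2.eventually he.locally_injective).and self_mem_nhdsWithin).exists
  exact (smul_eq_zero.1 (ht (h1 t))).resolve_left ht0

end

variable {n : ℕ} {E A ι : Type*} [NormedAddCommGroup E] [NormedSpace ℂ E] [CommGroup A]
  [TopologicalSpace A] [ChartedSpace E A] [LieGroup 𝓘(ℂ, E) ω A] {V : Type*}
  [NormedAddCommGroup V] [NormedSpace ℂ V] {e : V → A}
  {χ : ι → A →* ℂˣ} {ℓ : ι → V →L[ℂ] ℂ}

theorem _root_.IsHolExp.contMDiff_character (he : IsHolExp (E := E) e) (χ : A →* ℂˣ)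
    (ℓ : V →L[ℂ] ℂ) (h : ∀ v, (χ (e v) : ℂ) = Complex.exp (ℓ v)) :
    ContMDiff 𝓘(ℂ, E) 𝓘(ℂ, ℂ) ω χ := by
  intro a
  obtain ⟨g, hg, -, hag⟩ := he.contMDiffAt_iff.1 (contMDiffAt_id (I := 𝓘(ℂ, E)) (x := a))
  rw [contMDiffAt_units_iff]
  have h1 : ContMDiffAt 𝓘(ℂ, E) 𝓘(ℂ, ℂ) ω (fun x => (χ a : ℂ) * Complex.exp (ℓ (g x))) a := by
    refine ContMDiffAt.comp a (g := fun v => (χ a : ℂ) * Complex.exp (ℓ v)) ?_ hg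
    exact (contDiff_const.mul ℓ.contDiff.cexp).contMDiff.contMDiffAt
  refine h1.congr_of_eventuallyEq ?_
  filter_upwards [hag] with x hx
  have hx' : x = a * e (g x) := hx
  rw [← h, ← Units.val_mul, ← map_mul, ← hx']

/-- A map to a group with a separating family of characters is holomorphic if it is continuous and
its compositions with the characters are holomorphic. -/
theorem contMDiff_iff {e : (Fin n → ℂ) → A} {ℓ : ι → (Fin n → ℂ) →L[ℂ] ℂ}
    (hχ : IsSeparatingFamily e χ ℓ) (he : IsHolExp (E := E) e) {E' H M : Type*}
    [NormedAddCommGroup E'] [NormedSpace ℂ E'] [TopologicalSpace H] {I : ModelWithCorners ℂ E' H}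
    [TopologicalSpace M] [ChartedSpace H M] {f : M → A} :
    ContMDiff I 𝓘(ℂ, E) ω f ↔
      Continuous f ∧ ∀ i, ContMDiff I 𝓘(ℂ, ℂ) ω (fun t => χ i (f t)) := by
  constructor
  · intro hf
    exact ⟨hf.continuous, fun i => (he.contMDiff_character (χ i) (ℓ i) (hχ.apply_exp i)).comp hf⟩
  rintro ⟨hf, hfχ⟩ t
  have : IsTopologicalGroup A := topologicalGroup_of_lieGroup 𝓘(ℂ, E) ω
  obtain ⟨l, hl, hl1, hel, -⟩ := he.exists_log
  have h1 : Tendsto (fun s => (f t)⁻¹ * f s) (𝓝 t) (𝓝 1) := by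
    simpa using (hf.const_mul (f t)⁻¹).tendsto t
  set g := fun s => l ((f t)⁻¹ * f s) with hg
  have hg0 : Tendsto g (𝓝 t) (𝓝 0) := by
    have := hl.continuousAt.tendsto
    rw [hl1] at this
    exact this.comp h1
  have hfg : ∀ᶠ s in 𝓝 t, f s = f t * e (g s) := by
    filter_upwards [h1.eventually hel] with s hs
    rw [hg]
    simp only
    rw [hs, mul_inv_cancel_left]
  have hgt : g t = 0 := by simp [hg, hl1]
  -- The quotient of the values of `χ i` at `f s` and `f t` is `exp (ℓ i (g s))`. Near `t` the
  -- imaginary part of the exponent lies in `(-π, π)`, where the principal logarithm recovers it.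
  have hcoord : ∀ i, ContMDiffAt I 𝓘(ℂ, ℂ) ω (fun s => ℓ i (g s)) t := by
    intro i
    have h2 : ContMDiffAt I 𝓘(ℂ, ℂ) ω (fun s => ((χ i (f t) : ℂ))⁻¹ * (χ i (f s) : ℂ)) t := by
      refine ContMDiffAt.comp t (g := fun z : ℂ => ((χ i (f t) : ℂ))⁻¹ * z) ?_
        (contMDiffAt_units_iff.1 (hfχ i t))
      exact (contDiff_const.mul contDiff_id).contMDiff.contMDiffAt
    have h3 : ContMDiffAt I 𝓘(ℂ, ℂ) ω
        (fun s => Complex.log (((χ i (f t) : ℂ))⁻¹ * (χ i (f s) : ℂ))) t := by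
      refine ContMDiffAt.comp t (g := Complex.log) ?_ h2
      rw [inv_mul_cancel₀ (Units.ne_zero _)]
      exact (Complex.contDiffAt_log Complex.one_mem_slitPlane).contMDiffAt
    refine h3.congr_of_eventuallyEq ?_
    have h4 : Tendsto (fun s => (ℓ i (g s)).im) (𝓝 t) (𝓝 0) := by
      have := (Complex.continuous_im.comp (ℓ i).continuous).tendsto 0
      simp only [Function.comp, map_zero, Complex.zero_im] at this
      exact this.comp hg0
    filter_upwards [hfg, h4.eventually_lt_const Real.pi_pos,
      h4.eventually_const_lt (neg_lt_zero.2 Real.pi_pos)] with s hs h5 h6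
    rw [hs, map_mul, Units.val_mul, hχ.apply_exp, inv_mul_cancel_left₀ (Units.ne_zero _),
      Complex.log_exp h6 h5.le]
  obtain ⟨x, T, hT⟩ := exists_coordinates_of_separating ℓ fun v hv => hχ.eq_zero he.isExp hv
  refine he.contMDiffAt_iff.2 ⟨g, ?_, hgt, hfg⟩
  have h5 : ContMDiffAt I 𝓘(ℂ, Fin n → ℂ) ω (fun s => T (g s)) t := by
    rw [contMDiffAt_pi_space]
    intro j
    simp only [hT]
    exact hcoord (x j)
  have h6 : ContMDiffAt I 𝓘(ℂ, Fin n → ℂ) ω (fun s => T.symm (T (g s))) t :=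
    ContMDiffAt.comp t (g := T.symm) T.symm.contDiff.contMDiff.contMDiffAt h5
  simpa using h6

end IsSeparatingFamily

namespace IsExp

variable {n : ℕ} {A : Type u} {ι : Type*} [CommGroup A] [TopologicalSpace A] [IsTopologicalGroup A]
  {e : (Fin n → ℂ) → A} {χ : ι → A →* ℂˣ} {ℓ : ι → (Fin n → ℂ) →L[ℂ] ℂ}

/-- The characters themselves witness the Stein conditions: they separate points, `n` of them with
independent differentials are local coordinates, and the maxima of their moduli on `K` confine the
hull of `K` to a compact set supplied by `hbd`. The hull is also closed. -/
theorem isSteinManifold (h : IsExp e) (hχ : IsSeparatingFamily e χ ℓ)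
    (hbd : ∀ C : ι → ℝ, ∃ K : Set A, IsCompact K ∧ {a | ∀ i, ‖(χ i a : ℂ)‖ ≤ C i} ⊆ K) :
    letI := h.chartedSpace
    IsSteinManifold n A := by
  let := h.chartedSpace
  have hm : IsManifold 𝓘(ℂ, Fin n → ℂ) ω A := h.isManifold
  have hL : LieGroup 𝓘(ℂ, Fin n → ℂ) ω A := h.lieGroup
  have hχm : ∀ i, ContMDiff 𝓘(ℂ, Fin n → ℂ) 𝓘(ℂ, ℂ) ω (fun a => (χ i a : ℂ)) := fun i =>
    contMDiff_units_iff.1 (h.isHolExp.contMDiff_character (χ i) (ℓ i) (hχ.apply_exp i))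
  refine ⟨hm, fun x y hxy => ?_, fun a => ?_, fun K hK => ?_⟩
  · by_contra! hcon
    refine hxy (mul_inv_eq_one.1 (hχ.separating _ fun i => ?_))
    rw [map_mul, map_inv, mul_inv_eq_one]
    exact Units.ext (hcon _ (hχm i))
  · obtain ⟨x, T, hT⟩ := exists_coordinates_of_separating ℓ fun v hv => hχ.eq_zero h hv
    have hF : ∀ j, IsHolFun n A (fun b => (χ (x j) (a⁻¹ * b) : ℂ)) := fun j =>
      (hχm (x j)).comp (contMDiff_const.mul contMDiff_id)
    refine ⟨fun j b => (χ (x j) (a⁻¹ * b) : ℂ), hF, ?_⟩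
    -- In the exponential chart at `a`, the chosen characters, translated to be `1` at `a`, are the
    -- coordinatewise exponentials of the linear coordinates `T`; the principal logarithm inverts
    -- them.
    let Ψ : OpenPartialHomeomorph A (Fin n → ℂ) :=
      ((h.chart a).trans T.toHomeomorph.toOpenPartialHomeomorph).trans
        (OpenPartialHomeomorph.pi fun _ => Complex.expOpenPartialHomeomorph)
    have hΨ : ∀ b ∈ Ψ.source, (fun j => (χ (x j) (a⁻¹ * b) : ℂ)) = Ψ b := by
      intro b hb
      have h1 := h.mul_exp_chart hb.1.1
      funext j
      have h2 : Ψ b j = Complex.exp (T (h.chart a b) j) := rfl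
      rw [h2, hT, ← hχ.apply_exp, ← h1, inv_mul_cancel_left, h1]
    have hΨs : ∀ w, Ψ.symm w = a * e (T.symm (fun j => Complex.log (w j))) := fun w =>
      h.chart_symm_apply a _
    refine ⟨{ Ψ with
      contMDiffOn_toFun := ?_
      contMDiffOn_invFun := ?_ }, ?_, fun b hb => hΨ b hb⟩
    · refine ContMDiffOn.congr (f := fun b j => (χ (x j) (a⁻¹ * b) : ℂ)) ?_
        fun b hb => (hΨ b hb).symm
      exact (contMDiff_pi_space.2 hF).contMDiffOn
    · intro w hw
      refine ContMDiffAt.contMDiffWithinAt ?_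
      have hw' : ∀ j, w j ∈ Complex.slitPlane := fun j => hw.1 j trivial
      have h2 : ContMDiffAt 𝓘(ℂ, Fin n → ℂ) 𝓘(ℂ, Fin n → ℂ) ω
          (fun w : Fin n → ℂ => T.symm (fun j => Complex.log (w j))) w := by
        refine ContMDiffAt.comp w (g := T.symm) T.symm.contDiff.contMDiff.contMDiffAt ?_
        rw [contMDiffAt_pi_space]
        intro j
        exact ContMDiffAt.comp w (g := Complex.log) (f := fun w : Fin n → ℂ => w j)
          (Complex.contDiffAt_log (hw' j)).contMDiffAt
          (contDiff_apply ℂ ℂ j).contMDiff.contMDiffAt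
      have h3 : ContMDiffAt 𝓘(ℂ, Fin n → ℂ) 𝓘(ℂ, Fin n → ℂ) ω
          (fun w => a * e (T.symm (fun j => Complex.log (w j)))) w :=
        contMDiffAt_const.mul (ContMDiffAt.comp w (g := e) h.isHolExp.contMDiff.contMDiffAt h2)
      exact h3.congr_of_eventuallyEq (Eventually.of_forall hΨs)
    · refine ⟨⟨h.mem_chart_source a, trivial⟩, fun j _ => ?_⟩
      have : (T.toHomeomorph (h.chart a a)) j = 0 := by
        rw [h.chart_self]
        change T 0 j = 0
        simp
      change (T.toHomeomorph (h.chart a a)) j ∈ Complex.expOpenPartialHomeomorph.source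
      rw [this]
      simp [Complex.expOpenPartialHomeomorph, Real.pi_pos]
  · rcases K.eq_empty_or_nonempty with rfl | hne
    · have : holomorphicHull n A ∅ = ∅ := by
        ext x
        simp only [holomorphicHull, Set.mem_ofPred_eq, Set.mem_empty_iff_false, iff_false]
        intro hx
        obtain ⟨y, hy, -⟩ := hx (fun _ => 0) contMDiff_const
        exact hy
      rw [this]; exact isCompact_empty
    have hmax : ∀ f : A → ℂ, IsHolFun n A f → ∃ y ∈ K, ∀ z ∈ K, ‖f z‖ ≤ ‖f y‖ := fun f hf =>
      hK.exists_isMaxOn hne hf.continuous.norm.continuousOn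
    have hcl : IsClosed (holomorphicHull n A K) := by
      -- The maximum of `‖f‖` on `K` is attained, so each `f` imposes a single closed condition.
      have : holomorphicHull n A K =
          ⋂ f : {f : A → ℂ // IsHolFun n A f}, {x | ‖f.1 x‖ ≤ ‖f.1 (hmax f.1 f.2).choose‖} := by
        ext x
        simp only [holomorphicHull, Set.mem_ofPred_eq, Set.mem_iInter, Subtype.forall]
        refine forall₂_congr fun f hf => ⟨?_, fun hx => ⟨_, (hmax f hf).choose_spec.1, hx⟩⟩
        rintro ⟨y, hy, hxy⟩
        exact hxy.trans ((hmax f hf).choose_spec.2 y hy)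
      rw [this]
      exact isClosed_iInter fun f => isClosed_le f.2.continuous.norm continuous_const
    choose! y hy hymax using fun i => hmax _ (hχm i)
    obtain ⟨K', hK', hsub⟩ := hbd fun i => ‖(χ i (y i) : ℂ)‖
    refine hK'.of_isClosed_subset hcl fun x hx => hsub fun i => ?_
    obtain ⟨z, hz, hxz⟩ := hx _ (hχm i)
    exact hxz.trans (hymax i z hz)

end IsExp

/-! ### Compact generation, products and perfect pairings -/

/-- Compact generation in terms of the generated subgroup. -/
theorem isCompactlyGeneratedGroup_of_closure {A : Type*} [CommGroup A] [TopologicalSpace A]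
    [IsTopologicalGroup A] {K : Set A} (hK : IsCompact K) (h : Subgroup.closure K = ⊤) :
    IsCompactlyGeneratedGroup A := by
  set S := insert 1 (K ∪ K⁻¹) with hS
  have hS1 : (1 : A) ∈ S := Set.mem_insert _ _
  have hinv : S⁻¹ = S := by
    ext x
    simp only [hS, Set.mem_inv, Set.mem_insert_iff, Set.mem_union, inv_inv, inv_eq_one]
    tauto
  refine ⟨S, (hK.union hK.inv).insert 1, Set.eq_univ_of_forall fun x => ?_⟩
  have hx : x ∈ Subgroup.closure K := h ▸ Subgroup.mem_top x
  simp only [Set.mem_iUnion]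
  induction hx using Subgroup.closure_induction with
  | mem x hx => exact ⟨1, by rw [pow_one]; exact Set.mem_insert_of_mem _ (Or.inl hx)⟩
  | one => exact ⟨0, by simp⟩
  | mul x y _ _ hx hy =>
    obtain ⟨m, hm⟩ := hx
    obtain ⟨k, hk⟩ := hy
    exact ⟨m + k, by rw [pow_add]; exact Set.mul_mem_mul hm hk⟩
  | inv x _ hx =>
    obtain ⟨m, hm⟩ := hx
    refine ⟨m, ?_⟩
    rw [← hinv, inv_pow]
    exact Set.inv_mem_inv.2 hm

namespace IsExp

variable {V W A B : Type*} [NormedAddCommGroup V] [NormedAddCommGroup W] [CommGroup A]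
  [TopologicalSpace A] [CommGroup B] [TopologicalSpace B]

theorem prodMap {e : V → A} {e' : W → B} (h : IsExp e) (h' : IsExp e') :
    IsExp (Prod.map e e') := by
  refine ⟨fun v w => Prod.ext (h.map_add _ _) (h'.map_add _ _), ?_, ?_⟩
  · rw [Prod.zero_eq_mk, nhds_prod_eq, ← Filter.prod_map_map_eq', h.map_nhds, h'.map_nhds,
      Prod.one_eq_mk, nhds_prod_eq]
  · have h1 := (continuous_fst.tendsto (0 : V × W)).eventually h.locally_injective
    have h2 := (continuous_snd.tendsto (0 : V × W)).eventually h'.locally_injective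
    filter_upwards [h1, h2] with v h3 h4 hv
    exact Prod.ext (h3 (congrArg Prod.fst hv)) (h4 (congrArg Prod.snd hv))

theorem piMap {κ : Type*} [Fintype κ] {e : V → A} (h : IsExp e) :
    IsExp (fun (v : κ → V) i => e (v i)) := by
  refine ⟨fun v w => funext fun i => h.map_add _ _, ?_, ?_⟩
  · rw [nhds_pi, nhds_pi]
    have := map_piMap_pi_finite (fun _ : κ => e) (fun _ : κ => 𝓝 (0 : V))
    simp only [h.map_nhds] at this
    exact this
  · have h1 : ∀ᶠ v in 𝓝 (0 : κ → V), ∀ i, e (v i) = 1 → v i = 0 :=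
      eventually_all.2 fun i =>
        ((continuous_apply i).tendsto (0 : κ → V)).eventually h.locally_injective
    filter_upwards [h1] with v hv hv1
    exact funext fun i => hv i (congrFun hv1 i)

/-- A discrete group has the one-point space as its Lie algebra, which lets `ℤ` and finite groups be
treated together with `ℂ` and `ℂˣ`. -/
theorem of_discrete [DiscreteTopology A] : IsExp (fun _ : PUnit => (1 : A)) := by
  refine ⟨fun _ _ => (one_mul 1).symm, ?_, Eventually.of_forall fun _ _ => rfl⟩
  rw [nhds_discrete A]
  exact map_const

end IsExp

/-- The characters `p · b`, `b ∈ B`, are the holomorphic characters of the group `A` with the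
exponential map `e`, and the topology of `B` is the topology of uniform convergence on compact
sets; moreover, pointwise bounded subsets of `B` are relatively compact. -/
structure IsDualOf {V A B : Type*} [NormedAddCommGroup V] [NormedSpace ℂ V] [CommGroup A]
    [TopologicalSpace A] [CommGroup B] [TopologicalSpace B] (e : V → A) (p : A →* B →* ℂˣ) :
    Prop where
  apply_exp : ∀ b, ∃ ℓ : V →L[ℂ] ℂ, ∀ v, (p (e v) b : ℂ) = Complex.exp (ℓ v)
  surjective : ∀ χ : A →* ℂˣ, Continuous χ →
    (∃ ℓ : V →L[ℂ] ℂ, ∀ v, (χ (e v) : ℂ) = Complex.exp (ℓ v)) → ∃ b, ∀ a, χ a = p a b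
  nhds_one : ∀ U ∈ 𝓝 (1 : B), ∃ K : Set A, IsCompact K ∧ ∃ ε > 0,
    ∀ b, (∀ a ∈ K, ‖(p a b : ℂ) - 1‖ < ε) → b ∈ U
  bounded : ∀ C : A → ℝ, ∃ K : Set B, IsCompact K ∧ {b | ∀ a, ‖(p a b : ℂ)‖ ≤ C a} ⊆ K

/-- The product of two pairings. -/
noncomputable def prodPairing {A A' B B' : Type*} [CommGroup A] [CommGroup A'] [CommGroup B]
    [CommGroup B'] (p : A →* B →* ℂˣ) (p' : A' →* B' →* ℂˣ) : A × A' →* B × B' →* ℂˣ :=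
  ((MonoidHom.compHom' (MonoidHom.fst B B')).comp p).coprod
    ((MonoidHom.compHom' (MonoidHom.snd B B')).comp p')

theorem prodPairing_apply {A A' B B' : Type*} [CommGroup A] [CommGroup A'] [CommGroup B]
    [CommGroup B'] (p : A →* B →* ℂˣ) (p' : A' →* B' →* ℂˣ) (a : A × A') (b : B × B') :
    prodPairing p p' a b = p a.1 b.1 * p' a.2 b.2 := rfl

theorem flip_prodPairing {A A' B B' : Type*} [CommGroup A] [CommGroup A'] [CommGroup B]
    [CommGroup B'] (p : A →* B →* ℂˣ) (p' : A' →* B' →* ℂˣ) :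
    (prodPairing p p').flip = prodPairing p.flip p'.flip := by
  ext
  all_goals rfl

/-- The power of a pairing. -/
noncomputable def piPairing (κ : Type*) [Fintype κ] {A B : Type*} [CommGroup A] [CommGroup B]
    (p : A →* B →* ℂˣ) : (κ → A) →* (κ → B) →* ℂˣ :=
  ∏ i, (MonoidHom.compHom' (Pi.evalMonoidHom (fun _ : κ => B) i)).comp
    (p.comp (Pi.evalMonoidHom (fun _ : κ => A) i))

theorem piPairing_apply {κ : Type*} [Fintype κ] {A B : Type*} [CommGroup A] [CommGroup B]
    (p : A →* B →* ℂˣ) (a : κ → A) (b : κ → B) : piPairing κ p a b = ∏ i, p (a i) (b i) := by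
  rw [piPairing, MonoidHom.finsetProd_apply, MonoidHom.finsetProd_apply]
  rfl

theorem flip_piPairing {κ : Type*} [Fintype κ] {A B : Type*} [CommGroup A] [CommGroup B]
    (p : A →* B →* ℂˣ) : (piPairing κ p).flip = piPairing κ p.flip := by
  refine MonoidHom.ext fun b => MonoidHom.ext fun a => ?_
  rw [MonoidHom.flip_apply, piPairing_apply, piPairing_apply]
  rfl

theorem piPairing_mulSingle {κ : Type*} [Fintype κ] [DecidableEq κ] {A B : Type*}
    [CommGroup A] [CommGroup B] (p : A →* B →* ℂˣ) (i : κ)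
    (a : A) (b : κ → B) : piPairing κ p (Pi.mulSingle i a) b = p a (b i) := by
  rw [piPairing_apply, Finset.prod_eq_single i]
  · simp
  · intro j _ hj
    simp [Pi.mulSingle_eq_of_ne hj]
  · simp

namespace IsDualOf

variable {V W A B A' B' : Type*} [NormedAddCommGroup V] [NormedSpace ℂ V]
  [NormedAddCommGroup W] [NormedSpace ℂ W] [CommGroup A]
  [TopologicalSpace A] [CommGroup B] [TopologicalSpace B] [CommGroup A']
  [TopologicalSpace A'] [CommGroup B'] [TopologicalSpace B'] {e : V → A} {p : A →* B →* ℂˣ}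
  {e' : W → A'} {p' : A' →* B' →* ℂˣ}

/-- A character of a product is the product of its restrictions to the factors, so test compacta and
bounds may be taken on the two axes. -/
theorem prod (h : IsDualOf e p) (h' : IsDualOf e' p') (he : e 0 = 1) (he' : e' 0 = 1) :
    IsDualOf (Prod.map e e') (prodPairing p p') where
  apply_exp b := by
    obtain ⟨ℓ, hℓ⟩ := h.apply_exp b.1
    obtain ⟨ℓ', hℓ'⟩ := h'.apply_exp b.2
    refine ⟨ℓ.comp (ContinuousLinearMap.fst ℂ V W) + ℓ'.comp (ContinuousLinearMap.snd ℂ V W),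
      fun v => ?_⟩
    rw [prodPairing_apply, Units.val_mul]
    simp [hℓ, hℓ', Complex.exp_add]
  surjective χ hχ hℓ := by
    obtain ⟨ℓ, hℓ⟩ := hℓ
    obtain ⟨b, hb⟩ := h.surjective (χ.comp (MonoidHom.inl A A'))
      (hχ.comp (Continuous.prodMk_left 1))
      ⟨ℓ.comp (ContinuousLinearMap.inl ℂ V W), fun v => by
        have := hℓ (v, 0)
        rw [Prod.map_apply, he'] at this
        exact this⟩
    obtain ⟨b', hb'⟩ := h'.surjective (χ.comp (MonoidHom.inr A A'))
      (hχ.comp (Continuous.prodMk_right 1))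
      ⟨ℓ.comp (ContinuousLinearMap.inr ℂ V W), fun v => by
        have := hℓ (0, v)
        rw [Prod.map_apply, he] at this
        exact this⟩
    refine ⟨(b, b'), fun a => ?_⟩
    rw [prodPairing_apply, ← hb, ← hb', MonoidHom.comp_apply, MonoidHom.comp_apply, ← map_mul]
    simp
  nhds_one U hU := by
    rw [Prod.one_eq_mk, nhds_prod_eq, mem_prod_iff] at hU
    obtain ⟨U₁, hU₁, U₂, hU₂, hU⟩ := hU
    obtain ⟨K₁, hK₁, ε₁, hε₁, h₁⟩ := h.nhds_one U₁ hU₁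
    obtain ⟨K₂, hK₂, ε₂, hε₂, h₂⟩ := h'.nhds_one U₂ hU₂
    refine ⟨(fun a => (a, 1)) '' K₁ ∪ (fun a => (1, a)) '' K₂,
      (hK₁.image (Continuous.prodMk_left 1)).union (hK₂.image (Continuous.prodMk_right 1)),
      min ε₁ ε₂, lt_min hε₁ hε₂, fun b hb => hU ⟨h₁ _ fun a ha => ?_, h₂ _ fun a ha => ?_⟩⟩
    · have := hb (a, 1) (Or.inl ⟨a, ha, rfl⟩)
      simp only [prodPairing_apply, map_one, MonoidHom.one_apply, mul_one] at this
      exact this.trans_le (min_le_left _ _)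
    · have := hb (1, a) (Or.inr ⟨a, ha, rfl⟩)
      simp only [prodPairing_apply, map_one, MonoidHom.one_apply, one_mul] at this
      exact this.trans_le (min_le_right _ _)
  bounded C := by
    obtain ⟨K₁, hK₁, h₁⟩ := h.bounded fun a => C (a, 1)
    obtain ⟨K₂, hK₂, h₂⟩ := h'.bounded fun a => C (1, a)
    refine ⟨K₁ ×ˢ K₂, hK₁.prod hK₂, fun b hb => ⟨h₁ fun a => ?_, h₂ fun a => ?_⟩⟩
    · simpa [prodPairing_apply] using hb (a, 1)
    · simpa [prodPairing_apply] using hb (1, a)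

theorem pi {κ : Type*} [Fintype κ] (h : IsDualOf e p) (he : e 0 = 1) :
    IsDualOf (fun (v : κ → V) i => e (v i)) (piPairing κ p) where
  apply_exp b := by
    choose ℓ hℓ using h.apply_exp
    refine ⟨∑ i, (ℓ (b i)).comp (ContinuousLinearMap.proj i), fun v => ?_⟩
    rw [piPairing_apply, Units.coe_prod]
    simp [hℓ, Complex.exp_sum]
  surjective χ hχ hℓ := by
    classical
    obtain ⟨ℓ, hℓ⟩ := hℓ
    have h1 : ∀ i, ∃ b, ∀ a, χ (Pi.mulSingle i a) = p a b := fun i =>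
      h.surjective (χ.comp (MonoidHom.mulSingle (fun _ : κ => A) i))
        (hχ.comp (continuous_mulSingle (A := fun _ : κ => A) i))
        ⟨ℓ.comp (ContinuousLinearMap.single ℂ (fun _ : κ => V) i), fun v => by
          have h2 := hℓ (Pi.single i v)
          have h3 : (fun j => e ((Pi.single i v : κ → V) j)) = Pi.mulSingle i (e v) := by
            funext j
            rcases eq_or_ne j i with rfl | hj
            · simp
            · simp [hj, he]
          rw [h3] at h2
          exact h2⟩
    choose b hb using h1
    refine ⟨b, fun a => ?_⟩
    rw [← Finset.univ_prod_mulSingle a, map_prod, map_prod, MonoidHom.finsetProd_apply]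
    exact Finset.prod_congr rfl fun i _ => by rw [hb, piPairing_mulSingle]
  nhds_one U hU := by
    classical
    rw [nhds_pi, mem_pi] at hU
    obtain ⟨I, -, t, ht, hU⟩ := hU
    choose K hK ε hε hKε using fun i => h.nhds_one (t i) (ht i)
    -- There are finitely many factors, so one positive `δ` lies below all `ε i`, including the case
    -- of no factor at all.
    have hmin : ∀ᶠ δ in 𝓝[>] (0 : ℝ), ∀ i, δ < ε i :=
      eventually_all.2 fun i => nhdsWithin_le_nhds (Iio_mem_nhds (hε i))
    obtain ⟨δ, hδ, hδ0⟩ := (hmin.and self_mem_nhdsWithin).exists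
    refine ⟨⋃ i, Pi.mulSingle i '' K i,
      isCompact_iUnion fun i => (hK i).image (continuous_mulSingle (A := fun _ : κ => A) i), δ, hδ0,
      fun b hb => hU fun i _ => hKε i _ fun a ha => ?_⟩
    have := hb (Pi.mulSingle i a) (Set.mem_iUnion.2 ⟨i, a, ha, rfl⟩)
    rw [piPairing_mulSingle] at this
    exact this.trans (hδ i)
  bounded C := by
    classical
    choose K hK hKC using fun i : κ => h.bounded fun a => C (Pi.mulSingle i a)
    refine ⟨Set.univ.pi K, isCompact_univ_pi hK, fun b hb i _ => hKC i fun a => ?_⟩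
    have := hb (Pi.mulSingle i a)
    rwa [piPairing_mulSingle] at this

/-- An element pairing trivially with all of `A` lies in every neighbourhood of `1`, in particular
in `{b}ᶜ` if `b ≠ 1`. -/
theorem eq_one_of_apply_eq_one [T1Space B] (h : IsDualOf e p) {b : B} (hb : ∀ a, p a b = 1) : b = 1 := by
  by_contra hne
  obtain ⟨K, -, ε, hε, hK⟩ := h.nhds_one {b}ᶜ (isOpen_compl_singleton.mem_nhds (Ne.symm hne))
  exact hK b (fun a _ => by simp [hb, hε]) rfl

end IsDualOf

/-- `A` and `B` are in duality by the pairing `p`. -/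
structure IsPerfectPairing {V W A B : Type*} [NormedAddCommGroup V] [NormedSpace ℂ V]
    [NormedAddCommGroup W] [NormedSpace ℂ W] [CommGroup A] [TopologicalSpace A] [CommGroup B]
    [TopologicalSpace B] (e : V → A) (e' : W → B) (p : A →* B →* ℂˣ) : Prop where
  continuous : Continuous fun x : A × B => p x.1 x.2
  isExp_left : IsExp e
  isExp_right : IsExp e'
  left : IsDualOf e p
  right : IsDualOf e' p.flip
  compactlyGenerated : ∃ K : Set B, IsCompact K ∧ Subgroup.closure K = ⊤

namespace IsPerfectPairing

variable {V W V' W' A B A' B' : Type*} [NormedAddCommGroup V] [NormedSpace ℂ V]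
  [NormedAddCommGroup W] [NormedSpace ℂ W] [NormedAddCommGroup V'] [NormedSpace ℂ V']
  [NormedAddCommGroup W'] [NormedSpace ℂ W'] [CommGroup A]
  [TopologicalSpace A] [CommGroup B] [TopologicalSpace B] [CommGroup A']
  [TopologicalSpace A'] [CommGroup B'] [TopologicalSpace B'] {e : V → A} {f : W → B}
  {p : A →* B →* ℂˣ} {e' : V' → A'} {f' : W' → B'} {p' : A' →* B' →* ℂˣ}

theorem prod (h : IsPerfectPairing e f p) (h' : IsPerfectPairing e' f' p') :
    IsPerfectPairing (Prod.map e e') (Prod.map f f') (prodPairing p p') where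
  continuous := by
    simp only [prodPairing_apply]
    exact (h.continuous.comp ((continuous_fst.comp continuous_fst).prodMk
      (continuous_fst.comp continuous_snd))).mul (h'.continuous.comp
      ((continuous_snd.comp continuous_fst).prodMk (continuous_snd.comp continuous_snd)))
  isExp_left := h.isExp_left.prodMap h'.isExp_left
  isExp_right := h.isExp_right.prodMap h'.isExp_right
  left := h.left.prod h'.left h.isExp_left.map_zero h'.isExp_left.map_zero
  right := by
    rw [flip_prodPairing]
    exact h.right.prod h'.right h.isExp_right.map_zero h'.isExp_right.map_zero
  compactlyGenerated := by
    obtain ⟨K₁, hK₁, h₁⟩ := h.compactlyGenerated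
    obtain ⟨K₂, hK₂, h₂⟩ := h'.compactlyGenerated
    refine ⟨(fun a => (a, 1)) '' K₁ ∪ (fun a => (1, a)) '' K₂,
      (hK₁.image (Continuous.prodMk_left 1)).union (hK₂.image (Continuous.prodMk_right 1)), ?_⟩
    rw [Subgroup.closure_union]
    have h3 : Subgroup.closure ((fun a => (a, (1 : B'))) '' K₁) =
        (⊤ : Subgroup B).map (MonoidHom.inl B B') := by
      rw [← h₁, MonoidHom.map_closure]; rfl
    have h4 : Subgroup.closure ((fun a => ((1 : B), a)) '' K₂) =
        (⊤ : Subgroup B').map (MonoidHom.inr B B') := by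
      rw [← h₂, MonoidHom.map_closure]; rfl
    rw [h3, h4, eq_top_iff]
    intro x _
    have : x = (x.1, 1) * (1, x.2) := by simp
    rw [this]
    exact Subgroup.mul_mem_sup ⟨x.1, trivial, rfl⟩ ⟨x.2, trivial, rfl⟩

theorem pi (κ : Type*) [Fintype κ] (h : IsPerfectPairing e f p) :
    IsPerfectPairing (fun (v : κ → V) i => e (v i)) (fun (v : κ → W) i => f (v i))
      (piPairing κ p) where
  continuous := by
    simp only [piPairing_apply]
    exact continuous_finsetProd _ fun i _ => h.continuous.comp
      (f := fun x : (κ → A) × (κ → B) => (x.1 i, x.2 i)) (by fun_prop)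
  isExp_left := h.isExp_left.piMap
  isExp_right := h.isExp_right.piMap
  left := h.left.pi h.isExp_left.map_zero
  right := by
    rw [flip_piPairing]
    exact h.right.pi h.isExp_right.map_zero
  compactlyGenerated := by
    classical
    obtain ⟨K, hK, h₁⟩ := h.compactlyGenerated
    refine ⟨⋃ i, Pi.mulSingle i '' K, isCompact_iUnion fun i => hK.image (continuous_mulSingle (A := fun _ : κ => B) i),
      ?_⟩
    rw [Subgroup.closure_iUnion, eq_top_iff]
    intro x _
    rw [← Finset.univ_prod_mulSingle x]
    refine Subgroup.prod_mem _ fun i _ => Subgroup.mem_iSup_of_mem i ?_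
    have h3 : Subgroup.closure (Pi.mulSingle i '' K) =
        (⊤ : Subgroup B).map (MonoidHom.mulSingle (fun _ : κ => B) i) := by
      rw [← h₁, MonoidHom.map_closure]; rfl
    rw [h3]
    exact ⟨x i, trivial, rfl⟩

end IsPerfectPairing

/-! ### The elementary pairings of `ℂ`, `ℂˣ`, `ℤ` and finite groups -/

/-- The exponential function, with values in the group `ℂˣ`. -/
noncomputable def expUnits (z : ℂ) : ℂˣ := Units.mk0 (Complex.exp z) (Complex.exp_ne_zero z)

theorem expUnits_add (z w : ℂ) : expUnits (z + w) = expUnits z * expUnits w :=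
  Units.ext (Complex.exp_add z w)

theorem expUnits_log (x : ℂˣ) : expUnits (Complex.log x) = x :=
  Units.ext (Complex.exp_log x.ne_zero)

theorem continuous_expUnits : Continuous expUnits :=
  Units.isOpenEmbedding_val.isEmbedding.continuous_iff.2 Complex.continuous_exp

theorem isExp_expUnits : IsExp expUnits := by
  have h0 : expUnits 0 = 1 := Units.ext Complex.exp_zero
  refine ⟨expUnits_add, le_antisymm ?_ ?_, ?_⟩
  · have := continuous_expUnits.tendsto 0
    rwa [h0] at this
  · have h1 : Tendsto (fun x : ℂˣ => Complex.log x) (𝓝 1) (𝓝 0) := by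
      have h2 : ContinuousAt Complex.log ((1 : ℂˣ) : ℂ) :=
        continuousAt_clog Complex.one_mem_slitPlane
      have h3 := h2.comp (f := Units.val) (Units.continuous_val.continuousAt (x := (1 : ℂˣ)))
      simpa [ContinuousAt, Function.comp_def] using h3
    calc 𝓝 (1 : ℂˣ) = map (fun x : ℂˣ => expUnits (Complex.log x)) (𝓝 1) := by
          simp [expUnits_log]
      _ = map expUnits (map (fun x : ℂˣ => Complex.log x) (𝓝 1)) := by
          rw [map_map]; rfl
      _ ≤ map expUnits (𝓝 0) := map_mono h1
  · have h4 := (Complex.continuous_im.tendsto 0)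
    filter_upwards [h4.eventually_lt_const Real.pi_pos,
      h4.eventually_const_lt (neg_lt_zero.2 Real.pi_pos)] with z h5 h6 hz
    rw [← Complex.log_exp h6 h5.le]
    have : Complex.exp z = 1 := congrArg Units.val hz
    rw [this, Complex.log_one]

theorem isExp_ofAdd : IsExp (Multiplicative.ofAdd : ℂ → Multiplicative ℂ) :=
  ⟨fun _ _ => rfl, map_id, Eventually.of_forall fun _ h => h⟩

theorem IsExp.map_nsmul {V A : Type*} [NormedAddCommGroup V] [CommGroup A] [TopologicalSpace A]
    {e : V → A} (h : IsExp e) (k : ℕ) (v : V) : e (k • v) = e v ^ k := by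
  induction k with
  | zero => simp [h.map_zero]
  | succ k ih => rw [succ_nsmul, h.map_add, ih, pow_succ]

/-- Every vector is an integer multiple of one in the unit ball, so the image of that ball
generates. Dividing by `k + 1` instead of `k` avoids division by zero. -/
theorem IsExp.closure_image_closedBall {V A : Type*} [NormedAddCommGroup V] [NormedSpace ℂ V]
    [CommGroup A] [TopologicalSpace A] {e : V → A} (h : IsExp e) (he : Function.Surjective e) :
    Subgroup.closure (e '' Metric.closedBall 0 1) = ⊤ := by
  rw [eq_top_iff]
  intro x _
  obtain ⟨v, rfl⟩ := he x
  obtain ⟨k, hk⟩ := exists_nat_ge ‖v‖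
  have hk1 : (0 : ℝ) < k + 1 := by positivity
  have h1 : v = (k + 1) • ((k + 1 : ℂ)⁻¹ • v) := by
    rw [← Nat.cast_smul_eq_nsmul ℂ, smul_smul, Nat.cast_add_one,
      mul_inv_cancel₀ (Nat.cast_add_one_ne_zero k), one_smul]
  rw [h1, h.map_nsmul]
  refine Subgroup.pow_mem _ (Subgroup.subset_closure (Set.mem_image_of_mem e ?_)) _
  rw [mem_closedBall_zero_iff, norm_smul, norm_inv]
  have h2 : ‖(k + 1 : ℂ)‖ = k + 1 := by
    have := Complex.norm_natCast (k + 1)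
    push_cast at this
    exact this
  rw [h2, inv_mul_le_iff₀ hk1]
  linarith

/-- The pairing `(z, w) ↦ exp (z w)` of `ℂ` with itself. -/
noncomputable def expPairing : Multiplicative ℂ →* Multiplicative ℂ →* ℂˣ :=
  MonoidHom.mk' (fun z => MonoidHom.mk' (fun w => expUnits (z.toAdd * w.toAdd))
    fun w w' => by rw [toAdd_mul, mul_add, expUnits_add])
    fun z z' => MonoidHom.ext fun w => by
      simp [add_mul, expUnits_add]

theorem expPairing_apply (z w : Multiplicative ℂ) :
    (expPairing z w : ℂ) = Complex.exp (z.toAdd * w.toAdd) := rfl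

theorem isDualOf_expPairing : IsDualOf Multiplicative.ofAdd expPairing where
  apply_exp w := ⟨(ContinuousLinearMap.id ℂ ℂ).smulRight (w.toAdd), fun v => by
    simp [expPairing_apply]⟩
  surjective χ hχ hℓ := by
    obtain ⟨ℓ, hℓ⟩ := hℓ
    refine ⟨Multiplicative.ofAdd (ℓ 1), fun z => Units.ext ?_⟩
    have h1 : ℓ z.toAdd = z.toAdd * ℓ 1 := by
      rw [← smul_eq_mul, ← map_smul, smul_eq_mul, mul_one]
    rw [expPairing_apply, toAdd_ofAdd, ← h1, ← hℓ, ofAdd_toAdd]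
  nhds_one U hU := by
    obtain ⟨δ, hδ, hball⟩ := Metric.mem_nhds_iff.1 (show (Multiplicative.ofAdd ⁻¹' U : Set ℂ) ∈ 𝓝 0
      from continuous_ofAdd.continuousAt hU)
    refine ⟨Multiplicative.ofAdd '' Metric.closedBall (0 : ℂ) δ⁻¹,
      (isCompact_closedBall _ _).image continuous_ofAdd, 1, one_pos, fun w hw => ?_⟩
    refine hball (show w.toAdd ∈ Metric.ball (0 : ℂ) δ from mem_ball_zero_iff.2 ?_)
    by_contra! hle
    have hw0 : w.toAdd ≠ 0 := norm_pos_iff.1 (hδ.trans_le hle)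
    -- If `‖w‖ ≥ δ`, then `w⁻¹` lies in the test ball and the pairing takes the value `exp 1`, whose
    -- distance from `1` exceeds `1`.
    have h1 := hw (Multiplicative.ofAdd (w.toAdd)⁻¹) ⟨_, by
      rw [mem_closedBall_zero_iff, norm_inv]
      gcongr, rfl⟩
    rw [expPairing_apply, toAdd_ofAdd, inv_mul_cancel₀ hw0] at h1
    have h2 : Complex.exp 1 - 1 = ((Real.exp 1 - 1 : ℝ) : ℂ) := by simp
    rw [h2, Complex.norm_real, Real.norm_eq_abs] at h1
    have h3 := Real.add_one_lt_exp (x := 1) one_ne_zero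
    have h4 := le_abs_self (Real.exp 1 - 1)
    linarith
  bounded C := by
    let c := fun z : ℂ => C (Multiplicative.ofAdd z)
    refine ⟨Multiplicative.ofAdd '' Metric.closedBall (0 : ℂ) (max (c 1) (c (-1)) +
      max (c Complex.I) (c (-Complex.I))), (isCompact_closedBall _ _).image continuous_ofAdd,
      fun w hw => ⟨w.toAdd, ?_, rfl⟩⟩
    -- A bound on `‖exp (z w)‖` bounds `Re (z w)` from above; the four values `z = ±1, ±I` then
    -- bound the real and imaginary parts of `w`.
    have h1 : ∀ z : ℂ, (z * w.toAdd).re ≤ c z := by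
      intro z
      have h2 := hw (Multiplicative.ofAdd z)
      rw [expPairing_apply, Complex.norm_exp] at h2
      have h3 := Real.add_one_le_exp (z * w.toAdd).re
      change Real.exp (z * w.toAdd).re ≤ c z at h2
      linarith
    rw [mem_closedBall_zero_iff]
    refine (Complex.norm_le_abs_re_add_abs_im _).trans (add_le_add ?_ ?_)
    · refine abs_le'.2 ⟨le_max_of_le_left ?_, le_max_of_le_right ?_⟩
      · simpa using h1 1
      · simpa using h1 (-1)
    · refine abs_le'.2 ⟨le_max_of_le_right ?_, le_max_of_le_left ?_⟩
      · simpa using h1 (-Complex.I)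
      · simpa using h1 Complex.I

theorem isPerfectPairing_expPairing :
    IsPerfectPairing Multiplicative.ofAdd Multiplicative.ofAdd expPairing where
  continuous := continuous_expUnits.comp
    ((continuous_toAdd.comp continuous_fst).mul (continuous_toAdd.comp continuous_snd))
  isExp_left := isExp_ofAdd
  isExp_right := isExp_ofAdd
  left := isDualOf_expPairing
  right := by
    have : expPairing.flip = expPairing := MonoidHom.ext fun z => MonoidHom.ext fun w =>
      Units.ext (by rw [MonoidHom.flip_apply, expPairing_apply, expPairing_apply, mul_comm])
    rw [this]
    exact isDualOf_expPairing
  compactlyGenerated := ⟨_, (isCompact_closedBall _ _).image continuous_ofAdd,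
    isExp_ofAdd.closure_image_closedBall fun z => ⟨z.toAdd, rfl⟩⟩

/-- The pairing `(x, k) ↦ x ^ k` of `ℂˣ` with `ℤ`. -/
noncomputable def zpowPairing : ℂˣ →* Multiplicative ℤ →* ℂˣ := (zpowersMulHom ℂˣ).toMonoidHom

theorem zpowPairing_apply (x : ℂˣ) (k : Multiplicative ℤ) : zpowPairing x k = x ^ k.toAdd := rfl

/-- The period `2πi` of the exponential function forces the differential of a holomorphic character
of `ℂˣ` to be an integer. The single test point `2` isolates the trivial character, since `|2 ^ k -
1| < 1/2` only for `k = 0`, and the values at `2` and `2⁻¹` bound `k` on both sides. -/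
theorem isDualOf_zpowPairing : IsDualOf expUnits zpowPairing where
  apply_exp k := ⟨(ContinuousLinearMap.id ℂ ℂ).smulRight (k.toAdd : ℂ), fun v => by
    simp [zpowPairing_apply, expUnits, ← Complex.exp_int_mul, mul_comm]⟩
  surjective χ _ hℓ := by
    obtain ⟨ℓ, hℓ⟩ := hℓ
    have hlin : ∀ z, ℓ z = z * ℓ 1 := fun z => by
      rw [← smul_eq_mul, ← map_smul, smul_eq_mul, mul_one]
    have h1 : expUnits (2 * Real.pi * Complex.I) = 1 := Units.ext Complex.exp_two_pi_mul_I
    have h2 := hℓ (2 * Real.pi * Complex.I)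
    rw [h1, map_one, Units.val_one, hlin, eq_comm, Complex.exp_eq_one_iff] at h2
    obtain ⟨k, hk⟩ := h2
    have h3 : ℓ 1 = k := by
      rw [mul_comm] at hk
      exact mul_right_cancel₀ Complex.two_pi_I_ne_zero hk
    refine ⟨Multiplicative.ofAdd k, fun x => Units.ext ?_⟩
    conv_lhs => rw [← expUnits_log x]
    rw [hℓ, hlin, h3, mul_comm, Complex.exp_int_mul, Complex.exp_log x.ne_zero, zpowPairing_apply]
    simp
  nhds_one U hU := by
    refine ⟨{Units.mk0 2 two_ne_zero}, isCompact_singleton, 1 / 2, by norm_num, fun k hk => ?_⟩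
    have h1 := hk _ rfl
    rw [zpowPairing_apply, Units.val_zpow_eq_zpow_val, Units.val_mk0] at h1
    have h2 : (2 : ℂ) ^ k.toAdd - 1 = (((2 : ℝ) ^ k.toAdd - 1 : ℝ) : ℂ) := by push_cast; rfl
    rw [h2, Complex.norm_real, Real.norm_eq_abs, abs_lt] at h1
    have h3 : k.toAdd = 0 := by
      rcases lt_trichotomy k.toAdd 0 with h | h | h
      · have : (2 : ℝ) ^ k.toAdd ≤ 2 ^ (-1 : ℤ) := zpow_le_zpow_right₀ (by norm_num) (by omega)
        norm_num at this
        linarith [h1.1]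
      · exact h
      · have : (2 : ℝ) ^ (1 : ℤ) ≤ 2 ^ k.toAdd := zpow_le_zpow_right₀ (by norm_num) (by omega)
        norm_num at this
        linarith [h1.2]
    have h4 : k = 1 := h3
    rw [h4]
    exact mem_of_mem_nhds hU
  bounded C := by
    let two : ℂˣ := Units.mk0 2 two_ne_zero
    refine ⟨Multiplicative.ofAdd '' Set.Icc (-⌈C two⁻¹⌉) ⌈C two⌉,
      ((Set.finite_Icc _ _).image _).isCompact, fun k hk => ⟨k.toAdd, ?_, rfl⟩⟩
    have hpow : ∀ j : ℤ, (j : ℝ) ≤ 2 ^ j := by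
      intro j
      rcases le_or_gt 0 j with h | h
      · lift j to ℕ using h
        rw [zpow_natCast]
        exact_mod_cast Nat.lt_two_pow_self.le
      · have h1 : (j : ℝ) < 0 := by exact_mod_cast h
        have h2 : (0 : ℝ) < 2 ^ j := by positivity
        linarith
    have h1 := hk two
    have h2 := hk two⁻¹
    simp only [zpowPairing_apply, Units.val_zpow_eq_zpow_val, two,
      Units.val_mk0, norm_zpow, Complex.norm_ofNat, inv_zpow'] at h1 h2
    constructor
    · have h3 := (hpow (-k.toAdd)).trans (h2.trans (Int.le_ceil _))
      rw [Int.cast_le] at h3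
      exact neg_le.1 h3
    · have h3 := (hpow k.toAdd).trans (h1.trans (Int.le_ceil _))
      rw [Int.cast_le] at h3
      exact h3

theorem isDualOf_flip_zpowPairing : IsDualOf (fun _ : PUnit => 1) zpowPairing.flip where
  apply_exp x := ⟨0, fun v => by simp⟩
  surjective χ _ _ := by
    refine ⟨χ (Multiplicative.ofAdd 1), fun k => ?_⟩
    rw [MonoidHom.flip_apply, zpowPairing_apply, ← map_zpow, ← ofAdd_zsmul]
    simp
  nhds_one U hU := by
    rw [Units.isOpenEmbedding_val.isEmbedding.nhds_eq_comap, mem_comap] at hU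
    obtain ⟨t, ht, htU⟩ := hU
    obtain ⟨ε, hε, hball⟩ := Metric.mem_nhds_iff.1 ht
    refine ⟨{Multiplicative.ofAdd 1}, isCompact_singleton, ε, hε, fun x hx => htU (hball ?_)⟩
    have := hx _ rfl
    rw [MonoidHom.flip_apply, zpowPairing_apply, toAdd_ofAdd, zpow_one] at this
    rwa [Metric.mem_ball, dist_eq_norm]
  bounded C := by
    set c := C (Multiplicative.ofAdd 1)
    set d := C (Multiplicative.ofAdd (-1))
    -- The second inequality expresses `‖x⁻¹‖ ≤ d` as a closed condition on `ℂ` that fails at `0`,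
    -- so the set is compact already in `ℂ`.
    refine ⟨{x : ℂˣ | ‖(x : ℂ)‖ ≤ c ∧ 1 ≤ d * ‖(x : ℂ)‖}, ?_, fun x hx => ?_⟩
    · rw [Units.isOpenEmbedding_val.isInducing.isCompact_iff]
      have : Units.val '' {x : ℂˣ | ‖(x : ℂ)‖ ≤ c ∧ 1 ≤ d * ‖(x : ℂ)‖} =
          {z : ℂ | ‖z‖ ≤ c} ∩ {z : ℂ | 1 ≤ d * ‖z‖} := by
        ext z
        constructor
        · rintro ⟨x, hx, rfl⟩
          exact hx
        · intro hz
          have hz0 : z ≠ 0 := by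
            rintro rfl
            have := hz.2
            simp only [Set.mem_ofPred_eq, norm_zero, mul_zero] at this
            linarith
          exact ⟨Units.mk0 z hz0, hz, rfl⟩
      rw [this]
      refine (isCompact_closedBall (0 : ℂ) c).of_isClosed_subset
        ((isClosed_le continuous_norm continuous_const).inter
          (isClosed_le continuous_const (continuous_norm.const_mul d))) ?_
      rintro z ⟨hz, -⟩
      exact mem_closedBall_zero_iff.2 hz
    · have h1 := hx (Multiplicative.ofAdd 1)
      have h2 := hx (Multiplicative.ofAdd (-1))
      rw [MonoidHom.flip_apply, zpowPairing_apply, toAdd_ofAdd] at h1 h2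
      rw [zpow_one] at h1
      rw [zpow_neg_one, Units.val_inv_eq_inv_val, norm_inv] at h2
      exact ⟨h1, (inv_le_iff_one_le_mul₀ (norm_pos_iff.2 x.ne_zero)).1 h2⟩

theorem continuous_zpowPairing :
    Continuous fun x : ℂˣ × Multiplicative ℤ => zpowPairing x.1 x.2 := by
  refine continuous_iff_continuousAt.2 fun ⟨x, k⟩ => ?_
  rw [ContinuousAt, nhds_prod_eq, nhds_discrete (Multiplicative ℤ), Filter.prod_pure, tendsto_map'_iff]
  exact (continuous_zpow k.toAdd).tendsto x

theorem isPerfectPairing_zpowPairing :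
    IsPerfectPairing expUnits (fun _ : PUnit => 1) zpowPairing where
  continuous := continuous_zpowPairing
  isExp_left := isExp_expUnits
  isExp_right := IsExp.of_discrete
  left := isDualOf_zpowPairing
  right := isDualOf_flip_zpowPairing
  compactlyGenerated := by
    refine ⟨{Multiplicative.ofAdd 1}, isCompact_singleton, ?_⟩
    rw [eq_top_iff]
    intro k _
    refine Subgroup.mem_closure_singleton.2 ⟨k.toAdd, ?_⟩
    rw [← ofAdd_zsmul]
    simp

theorem isPerfectPairing_flip_zpowPairing :
    IsPerfectPairing (fun _ : PUnit => 1) expUnits zpowPairing.flip where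
  continuous := continuous_zpowPairing.comp continuous_swap
  isExp_left := IsExp.of_discrete
  isExp_right := isExp_expUnits
  left := isDualOf_flip_zpowPairing
  right := isDualOf_zpowPairing
  compactlyGenerated := ⟨_, (isCompact_closedBall _ _).image continuous_expUnits,
    isExp_expUnits.closure_image_closedBall fun x => ⟨_, expUnits_log x⟩⟩

theorem IsDualOf.of_finite {F F' : Type*} [CommGroup F] [Finite F] [TopologicalSpace F]
    [CommGroup F'] [Finite F'] [TopologicalSpace F'] (p : F →* F' →* ℂˣ) (hinj : ∀ b, (∀ a, p a b = 1) → b = 1)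
    (hsurj : ∀ χ : F →* ℂˣ, ∃ b, ∀ a, χ a = p a b) :
    IsDualOf (fun _ : PUnit => (1 : F)) p where
  apply_exp b := ⟨0, fun v => by simp⟩
  surjective χ _ _ := hsurj χ
  nhds_one U hU := by
    -- Finitely many values occur, so some `δ` is below the distance from `1` of each nontrivial
    -- one; a character `δ`-close to `1` is then trivial.
    have h1 : ∀ᶠ δ in 𝓝[>] (0 : ℝ), ∀ b a, p a b ≠ 1 → δ < ‖(p a b : ℂ) - 1‖ := by
      refine eventually_all.2 fun b => eventually_all.2 fun a => ?_
      by_cases h : p a b = 1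
      · simp [h]
      · have : 0 < ‖(p a b : ℂ) - 1‖ := norm_pos_iff.2 (sub_ne_zero.2 fun h' => h (Units.ext h'))
        filter_upwards [nhdsWithin_le_nhds (Iio_mem_nhds this)] with δ hδ _
        exact hδ
    obtain ⟨δ, hδ, hδ0⟩ := (h1.and self_mem_nhdsWithin).exists
    refine ⟨Set.univ, Set.finite_univ.isCompact, δ, hδ0, fun b hb => ?_⟩
    have : b = 1 := by
      refine hinj b fun a => ?_
      by_contra h
      exact lt_asymm (hδ b a h) (hb a trivial)
    rw [this]
    exact mem_of_mem_nhds hU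
  bounded C := ⟨Set.univ, Set.finite_univ.isCompact, Set.subset_univ _⟩

theorem isPerfectPairing_eval (F : Type*) [CommGroup F] [Finite F] [TopologicalSpace F]
    [DiscreteTopology F] [TopologicalSpace (F →* ℂˣ)] [DiscreteTopology (F →* ℂˣ)] :
    IsPerfectPairing (fun _ : PUnit => (1 : F)) (fun _ : PUnit => (1 : F →* ℂˣ))
      MonoidHom.eval where
  continuous := continuous_of_discreteTopology
  isExp_left := IsExp.of_discrete
  isExp_right := IsExp.of_discrete
  left := by
    refine IsDualOf.of_finite _ (fun χ hχ => MonoidHom.ext hχ) fun χ => ⟨χ, fun a => rfl⟩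
  right := by
    -- Reflexivity of a finite Abelian group needs roots of unity in `ℂ` of order its exponent,
    -- hence a nonzero exponent.
    have : NeZero (Monoid.exponent F) := ⟨Monoid.exponent_ne_zero_of_finite⟩
    refine IsDualOf.of_finite _ (fun a ha => ?_) fun Φ =>
      ⟨CommGroup.monoidHomMonoidHomEquiv F ℂ Φ,
        fun χ => (CommGroup.apply_monoidHomMonoidHomEquiv ℂ χ Φ).symm⟩
    refine (CommGroup.forall_apply_eq_apply_iff F (M := ℂ)).1 fun χ => ?_
    rw [map_one]
    exact ha χ
  compactlyGenerated := ⟨Set.univ, Set.finite_univ.isCompact, Subgroup.closure_univ⟩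

/-! ### The period lattice of the exponential map -/

/-- A discrete subgroup of a real vector space is spanned by linearly independent vectors. -/
theorem exists_linearIndependent_span_int_eq {E : Type*} [NormedAddCommGroup E] [NormedSpace ℝ E]
    [FiniteDimensional ℝ E] (Γ : Submodule ℤ E) [DiscreteTopology Γ] :
    ∃ (r : ℕ) (b : Fin r → E), LinearIndependent ℝ b ∧ Submodule.span ℤ (Set.range b) = Γ := by
  -- Inside its real span the discrete subgroup is a full lattice, whose integral bases are real
  -- bases.
  let F := Submodule.span ℝ (Γ : Set E)
  let L : Submodule ℤ F := Submodule.comap (F.restrictScalars ℤ).subtype Γ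
  have hΓF : Γ ≤ F.restrictScalars ℤ := Submodule.subset_span
  let f := Submodule.comapSubtypeEquivOfLe hΓF
  have : DiscreteTopology L := by
    let e : Γ ≃L[ℤ] L :=
      ⟨f.symm, continuous_of_discreteTopology, Isometry.continuous fun _ ↦ congrFun rfl⟩
    exact e.toHomeomorph.discreteTopology
  have : IsZLattice ℝ L := ⟨Submodule.span_span_coe_preimage⟩
  have : Module.Finite ℤ L := ZLattice.module_finite ℝ L
  have : Module.Free ℤ L := ZLattice.module_free ℝ L
  let b₀ := Module.finBasis ℤ L
  let b := b₀.ofZLatticeBasis ℝ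
  refine ⟨Module.finrank ℤ L, fun i => (b i : E), ?_, ?_⟩
  · exact b.linearIndependent.map' F.subtype (Submodule.ker_subtype F)
  · have h1 : Submodule.span ℤ (Set.range b) = L := b₀.ofZLatticeBasis_span ℝ
    let j : F →ₗ[ℤ] E := F.subtype.restrictScalars ℤ
    have h2 : Set.range (fun i => (b i : E)) = j '' Set.range b := Set.range_comp j b
    rw [h2, Submodule.span_image, h1]
    ext v
    refine ⟨?_, fun hv => ⟨⟨v, hΓF hv⟩, hv, rfl⟩⟩
    rintro ⟨w, hw, rfl⟩
    exact hw

namespace IsExp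

variable {V A : Type*} [NormedAddCommGroup V] [CommGroup A] [TopologicalSpace A]
  {e : V → A}

/-- The kernel of an exponential map. -/
def ker (h : IsExp e) : Submodule ℤ V where
  carrier := {v | e v = 1}
  zero_mem' := h.map_zero
  add_mem' {v w} hv hw := by
    change e (v + w) = 1
    rw [h.map_add, show e v = 1 from hv, show e w = 1 from hw, one_mul]
  smul_mem' n v hv := by
    have hv' : e v = 1 := hv
    change e (n • v) = 1
    obtain ⟨k, rfl | rfl⟩ := n.eq_nat_or_neg
    · rw [natCast_zsmul, h.map_nsmul, hv', one_pow]
    · rw [neg_smul, natCast_zsmul, h.map_neg, h.map_nsmul, hv', one_pow, inv_one]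

theorem mem_ker (h : IsExp e) {v : V} : v ∈ h.ker ↔ e v = 1 := Iff.rfl

theorem discreteTopology_ker (h : IsExp e) : DiscreteTopology h.ker := by
  have h1 : ({0} : Set h.ker) ∈ 𝓝 0 := by
    rw [nhds_subtype_eq_comap, mem_comap]
    exact ⟨_, h.locally_injective, fun v hv => Subtype.ext (hv v.2)⟩
  exact discreteTopology_of_isOpen_singleton_zero
    (isOpen_singleton_iff_nhds_eq_pure _ |>.2
      (le_antisymm (le_pure_iff.2 h1) (pure_le_nhds _)))

end IsExp

/-- If holomorphic functions separate the points of the group, a lattice basis of the kernel of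
its exponential map is linearly independent over `ℂ`. -/
theorem IsHolExp.linearIndependent_of_separable {V E A : Type*} [NormedAddCommGroup V]
    [NormedSpace ℂ V] [NormedAddCommGroup E] [NormedSpace ℂ E] [CommGroup A] [TopologicalSpace A]
    [ChartedSpace E A] {e : V → A} (he : IsHolExp (E := E) e)
    (hsep : ∀ x y : A, x ≠ y → ∃ f : A → ℂ, ContMDiff 𝓘(ℂ, E) 𝓘(ℂ, ℂ) ω f ∧ f x ≠ f y)
    {κ : Type*} [Fintype κ] {b : κ → V} (hb : ∀ i, e (b i) = 1)
    (hlin : ∀ x : κ → ℝ, ∑ i, (x i : ℂ) • b i = 0 → x = 0) : LinearIndependent ℂ b := by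
  have hexp : IsExp e := he.isExp
  let g : (κ → ℝ) → V := fun x => ∑ i, (x i : ℂ) • b i
  have hg : Continuous g := by
    refine continuous_finsetSum _ fun i _ => ?_
    exact (Complex.continuous_ofReal.comp (continuous_apply i)).smul continuous_const
  have hker : ∀ i, b i ∈ hexp.ker := hb
  -- Integer parts of the coordinates contribute periods, so the image of the real span under `e` is
  -- the image of the unit cube, hence compact.
  have hper : ∀ x : κ → ℝ, e (g x) = e (g fun i => Int.fract (x i)) := by
    intro x
    have h1 : g x - g (fun i => Int.fract (x i)) ∈ hexp.ker := by
      have : g x - g (fun i => Int.fract (x i)) = ∑ i, (⌊x i⌋ : ℤ) • b i := by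
        simp only [g]
        rw [← Finset.sum_sub_distrib]
        refine Finset.sum_congr rfl fun i _ => ?_
        rw [← sub_smul, ← Int.cast_smul_eq_zsmul ℂ]
        congr 1
        rw [← Complex.ofReal_sub, Int.self_sub_fract, Complex.ofReal_intCast]
      rw [this]
      exact Submodule.sum_mem _ fun i _ => Submodule.smul_mem _ _ (hker i)
    rw [hexp.mem_ker, hexp.map_sub, div_eq_one] at h1
    exact h1
  let C : Set A := (fun x => e (g x)) '' Set.univ.pi fun _ : κ => Set.Icc (0 : ℝ) 1
  have hC : IsCompact C := (isCompact_univ_pi fun _ => isCompact_Icc).image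
    (he.contMDiff.continuous.comp hg)
  have hmemC : ∀ x, e (g x) ∈ C := fun x => ⟨fun i => Int.fract (x i), fun i _ =>
    ⟨Int.fract_nonneg _, (Int.fract_lt_one _).le⟩, (hper x).symm⟩
  rw [Fintype.linearIndependent_iff]
  intro c hc
  set x : κ → ℝ := fun i => (c i).re with hx
  set y : κ → ℝ := fun i => (c i).im with hy
  have hxy : g x + Complex.I • g y = 0 := by
    rw [← hc]
    simp only [g, Finset.smul_sum, smul_smul]
    rw [← Finset.sum_add_distrib]
    refine Finset.sum_congr rfl fun i _ => ?_
    rw [← add_smul]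
    congr 1
    rw [mul_comm]
    exact Complex.re_add_im (c i)
  have hgy : g y = Complex.I • g x := by
    have h1 := congrArg (fun v => Complex.I • v) hxy
    simp only [smul_add, smul_smul, Complex.I_mul_I, smul_zero, neg_smul, one_smul] at h1
    rw [← sub_eq_add_neg, sub_eq_zero] at h1
    exact h1.symm
  -- A complex relation with coefficients `x + i y` gives `g y = i g x`, so the whole complex line
  -- through `g x` lies in the real span of the `b i`.
  have hline : ∀ z : ℂ, z • g x = g (fun i => z.re * x i + z.im * y i) := by
    intro z
    have h1 : g (fun i => z.re * x i + z.im * y i) = (z.re : ℂ) • g x + (z.im : ℂ) • g y := by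
      simp only [g, Finset.smul_sum, smul_smul]
      rw [← Finset.sum_add_distrib]
      refine Finset.sum_congr rfl fun i _ => ?_
      rw [← add_smul]
      push_cast
      rfl
    rw [h1, hgy, smul_smul, ← add_smul, Complex.re_add_im]
  -- Liouville: a holomorphic function on the group restricts to a bounded entire function on this
  -- line, hence to a constant, so it cannot separate the points of the image from `1`.
  have hconst : ∀ z : ℂ, e (z • g x) = 1 := by
    intro z
    by_contra hne
    obtain ⟨f, hf, hfne⟩ := hsep _ _ hne
    refine hfne ?_
    have hd : Differentiable ℂ fun z : ℂ => f (e (z • g x)) := by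
      have h1 : ContMDiff 𝓘(ℂ, ℂ) 𝓘(ℂ, ℂ) ω fun z : ℂ => f (e (z • g x)) := by
        refine hf.comp (he.contMDiff.comp ?_)
        exact (contDiff_id.smul contDiff_const).contMDiff
      exact h1.contDiff.differentiable (by simp)
    have hbd : Bornology.IsBounded (Set.range fun z : ℂ => f (e (z • g x))) := by
      refine (hC.image hf.continuous).isBounded.subset ?_
      rintro _ ⟨z, rfl⟩
      simp only [hline]
      exact Set.mem_image_of_mem f (hmemC _)
    have h2 := hd.apply_eq_apply_of_bounded hbd z 0
    simp only [zero_smul, hexp.map_zero] at h2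
    exact h2
  have hgx : g x = 0 := by
    have h2 : Tendsto (fun t : ℂ => t • g x) (𝓝[≠] 0) (𝓝 0) := by
      have : Tendsto (fun t : ℂ => t • g x) (𝓝 0) (𝓝 ((0 : ℂ) • g x)) :=
        (continuous_id.smul continuous_const).tendsto (0 : ℂ)
      rw [zero_smul] at this
      exact this.mono_left nhdsWithin_le_nhds
    obtain ⟨t, ht, ht0⟩ :=
      ((h2.eventually hexp.locally_injective).and self_mem_nhdsWithin).exists
    exact (smul_eq_zero.1 (ht (hconst t))).resolve_left ht0
  have hx0 := hlin x hgx
  have hy0 := hlin y (by rw [hgx, smul_zero] at hgy; exact hgy)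
  intro i
  exact Complex.ext (congrFun hx0 i) (congrFun hy0 i)

theorem Module.Basis.sumExtend_inl {K V ι : Type*} [DivisionRing K] [AddCommGroup V] [Module K V]
    {v : ι → V} (hs : LinearIndependent K v) (i : ι) :
    Module.Basis.sumExtend hs (Sum.inl i) = v i := by
  simp only [Module.Basis.sumExtend, Module.Basis.reindex_apply, Module.Basis.extend_apply_self]
  rfl

/-- The kernel of the exponential map of a group whose points are separated by holomorphic
functions, in suitable coordinates. -/
theorem IsHolExp.exists_coordinates {n : ℕ} {E A : Type*} [NormedAddCommGroup E]
    [NormedSpace ℂ E] [CommGroup A] [TopologicalSpace A] [ChartedSpace E A]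
    {e : (Fin n → ℂ) → A} (he : IsHolExp (E := E) e)
    (hsep : ∀ x y : A, x ≠ y → ∃ f : A → ℂ, ContMDiff 𝓘(ℂ, E) 𝓘(ℂ, ℂ) ω f ∧ f x ≠ f y) :
    ∃ (κ κ' : Type) (_ : Fintype κ) (_ : Fintype κ')
      (T : (Fin n → ℂ) ≃ₗ[ℂ] (κ → ℂ) × (κ' → ℂ)),
      ∀ v, e v = 1 ↔ (∀ i, expUnits ((T v).1 i) = 1) ∧ (T v).2 = 0 := by
  have hexp : IsExp e := he.isExp
  have := hexp.discreteTopology_ker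
  obtain ⟨r, b, hb, hspan⟩ := exists_linearIndependent_span_int_eq hexp.ker
  have hbker : ∀ i, e (b i) = 1 := fun i => by
    have : b i ∈ hexp.ker := hspan ▸ Submodule.subset_span ⟨i, rfl⟩
    exact this
  have hbC : LinearIndependent ℂ b := by
    refine he.linearIndependent_of_separable hsep hbker fun x hx => ?_
    have hx' : ∑ i, x i • b i = 0 := by
      rw [← hx]
      exact Finset.sum_congr rfl fun i _ => (Complex.coe_smul _ _).symm
    exact funext (Fintype.linearIndependent_iff.1 hb x hx')
  let B := Module.Basis.sumExtend hbC
  have hfin : Finite (Fin r ⊕ Module.Basis.sumExtendIndex hbC) :=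
    Module.Finite.finite_basis B
  have : Fintype (Module.Basis.sumExtendIndex hbC) :=
    @Fintype.ofFinite _ (Finite.of_injective
      (Sum.inr : _ → Fin r ⊕ Module.Basis.sumExtendIndex hbC) Sum.inr_injective)
  let T₀ : (Fin n → ℂ) ≃ₗ[ℂ] (Fin r → ℂ) × (Module.Basis.sumExtendIndex hbC → ℂ) :=
    B.equivFun.trans (LinearEquiv.sumArrowLequivProdArrow _ _ ℂ ℂ)
  -- Scaling by `2πi` turns the integer lattice into the kernel of the coordinatewise exponential.
  let S : (Fin r → ℂ) ≃ₗ[ℂ] (Fin r → ℂ) :=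
    LinearEquiv.smulOfUnit (Units.mk0 (2 * Real.pi * Complex.I) Complex.two_pi_I_ne_zero)
  let T := T₀.trans (S.prodCongr (LinearEquiv.refl ℂ (Module.Basis.sumExtendIndex hbC → ℂ)))
  have hT1 : ∀ v i, (T v).1 i = 2 * Real.pi * Complex.I * B.repr v (Sum.inl i) := fun v i => rfl
  have hT2 : ∀ v i, (T v).2 i = B.repr v (Sum.inr i) := fun v i => rfl
  refine ⟨Fin r, _, inferInstance, inferInstance, T, fun v => ?_⟩
  have hexp1 : ∀ z : ℂ, expUnits (2 * Real.pi * Complex.I * z) = 1 ↔ ∃ k : ℤ, z = k := by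
    intro z
    rw [Units.ext_iff]
    change Complex.exp _ = 1 ↔ _
    rw [Complex.exp_eq_one_iff]
    refine exists_congr fun k => ?_
    rw [mul_comm]
    exact mul_left_inj' Complex.two_pi_I_ne_zero
  constructor
  · intro hv
    have hv' : v ∈ Submodule.span ℤ (Set.range b) := hspan.symm ▸ hv
    obtain ⟨k, rfl⟩ := (Submodule.mem_span_range_iff_exists_fun ℤ).1 hv'
    have hrep : ∑ i, k i • b i = ∑ i, (k i : ℂ) • B (Sum.inl i) := by
      refine Finset.sum_congr rfl fun i _ => ?_
      rw [Module.Basis.sumExtend_inl, Int.cast_smul_eq_zsmul]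
    refine ⟨fun i => ?_, funext fun i => ?_⟩
    · rw [hT1, hexp1]
      refine ⟨k i, ?_⟩
      rw [hrep]
      simp [Finsupp.single_apply]
    · rw [hT2, hrep]
      simp
  · rintro ⟨h1, h2⟩
    have h1' : ∀ i, ∃ k : ℤ, B.repr v (Sum.inl i) = k := fun i => by
      rw [← hexp1, ← hT1]; exact h1 i
    choose k hk using h1'
    have hv : v = ∑ i, k i • b i := by
      rw [← B.sum_repr v, Fintype.sum_sum_type]
      have h3 : ∀ i, B.repr v (Sum.inr i) = 0 := fun i => by
        rw [← hT2, h2]; rfl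
      simp only [h3, zero_smul, Finset.sum_const_zero, add_zero, hk]
      refine Finset.sum_congr rfl fun i _ => ?_
      rw [Module.Basis.sumExtend_inl, Int.cast_smul_eq_zsmul]
    have : v ∈ hexp.ker := by
      rw [hv]
      exact Submodule.sum_mem _ fun i _ => Submodule.smul_mem _ _ (hbker i)
    exact this

/-! ### Splitting a compactly generated group into elementary factors -/

/-- Modulo an open subgroup the group is discrete, so the image of the compact generating set is
finite. -/
theorem IsCompactlyGeneratedGroup.fg_quotient {A : Type*} [CommGroup A] [TopologicalSpace A]
    [IsTopologicalGroup A] (h : IsCompactlyGeneratedGroup A) {H : Subgroup A}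
    (hH : IsOpen (H : Set A)) : Group.FG (A ⧸ H) := by
  obtain ⟨K, hK, hKu⟩ := h
  have hd : DiscreteTopology (A ⧸ H) := QuotientGroup.discreteTopology hH
  have hpow : ∀ n : ℕ, K ^ n ⊆ Subgroup.closure K := by
    intro n
    induction n with
    | zero => simp
    | succ n ih =>
      rw [pow_succ]
      rintro _ ⟨x, hx, y, hy, rfl⟩
      exact Subgroup.mul_mem _ (ih hx) (Subgroup.subset_closure hy)
  have htop : Subgroup.closure K = ⊤ := by
    rw [eq_top_iff]
    intro x _
    have hx : x ∈ ⋃ n : ℕ, K ^ n := hKu ▸ Set.mem_univ x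
    obtain ⟨n, hn⟩ := Set.mem_iUnion.1 hx
    exact hpow n hn
  refine Group.fg_iff.2 ⟨QuotientGroup.mk' H '' K, ?_, ?_⟩
  · rw [← MonoidHom.map_closure, htop]
    exact Subgroup.map_top_of_surjective _ (QuotientGroup.mk'_surjective H)
  · exact (hK.image QuotientGroup.continuous_mk).finite_of_discrete

theorem CommGroup.exists_equiv_free_prod_finite (D : Type*) [CommGroup D] [Group.FG D] :
    ∃ (j : Type) (_ : Fintype j) (F : Type) (_ : CommGroup F) (_ : Finite F),
      Nonempty (D ≃* (j → Multiplicative ℤ) × F) := by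
  obtain ⟨ι, j, _, _, p, hp, k, ⟨φ⟩⟩ := CommGroup.equiv_free_prod_prod_multiplicative_zmod D
  have : ∀ i, NeZero (p i ^ k i) := fun i => ⟨pow_ne_zero _ (hp i).ne_zero⟩
  exact ⟨j, inferInstance, ∀ i, Multiplicative (ZMod (p i ^ k i)), inferInstance, inferInstance, ⟨φ⟩⟩

/-- Homomorphisms to quotients of `ℂ^n` extend from subgroups. -/
theorem MonoidHom.exists_extension_of_surjective {n : ℕ} {A Q : Type*} [CommGroup A] [CommGroup Q]
    (q : Multiplicative (Fin n → ℂ) →* Q) (hq : Function.Surjective q) (H : Subgroup A)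
    (f : H →* Q) : ∃ g : A →* Q, ∀ x : H, g x = f x := by
  let q' : (Fin n → ℂ) →+ Additive Q := MonoidHom.toAdditiveRight q
  have hq' : Function.Surjective q' := hq
  -- A quotient of `ℂ^n` is divisible, hence injective as an Abelian group by Baer's criterion.
  let : DivisibleBy (Additive Q) ℤ := hq'.divisibleBy q' fun a k => map_zsmul q' k a
  obtain ⟨g, hg⟩ := (Module.Baer.of_divisible (Additive Q)).extension_property_addMonoidHom
    (MonoidHom.toAdditive H.subtype) H.subtype_injective (MonoidHom.toAdditive f)
  exact ⟨MonoidHom.toAdditive.symm g, fun x => DFunLike.congr_fun hg (Additive.ofMul x)⟩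

/-- Neighbourhoods of `1` are images under `e` of neighbourhoods of `0`, so continuity of a
homomorphism reduces to that of its lift `T`. Algebraic isomorphisms that are linear in exponential
coordinates are therefore homeomorphisms. -/
theorem IsExp.continuous_of_comp_eq {V V' A A' : Type*} [NormedAddCommGroup V]
    [NormedAddCommGroup V'] [CommGroup A] [TopologicalSpace A] [IsTopologicalGroup A]
    [CommGroup A'] [TopologicalSpace A'] [IsTopologicalGroup A'] {e : V → A} {e' : V' → A'}
    (h : IsExp e) (h' : IsExp e') (φ : A →* A') (T : V → V') (hT : Continuous T) (hT0 : T 0 = 0)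
    (hφ : ∀ v, φ (e v) = e' (T v)) : Continuous φ := by
  refine continuous_of_continuousAt_one φ ?_
  rw [ContinuousAt, map_one, Tendsto, ← h.map_nhds, map_map]
  have h1 : Tendsto T (𝓝 0) (𝓝 0) := by
    have := hT.tendsto 0
    rwa [hT0] at this
  have h2 : φ ∘ e = e' ∘ T := funext hφ
  rw [h2]
  exact h'.tendsto_zero.comp h1

theorem IsExp.comp_equiv {V V' A : Type*} [NormedAddCommGroup V] [NormedSpace ℂ V]
    [NormedAddCommGroup V'] [NormedSpace ℂ V'] [CommGroup A] [TopologicalSpace A]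
    {e : V → A} (h : IsExp e) (T : V' ≃L[ℂ] V) : IsExp (fun v => e (T v)) := by
  refine ⟨fun v w => by rw [_root_.map_add, h.map_add], ?_, ?_⟩
  · have h1 : map T (𝓝 0) = 𝓝 0 := by
      have := T.toHomeomorph.map_nhds_eq 0
      simpa using this
    rw [← h.map_nhds, ← h1, map_map]
    rfl
  · have h1 : Tendsto T (𝓝 0) (𝓝 0) := by simpa using T.continuous.tendsto 0
    filter_upwards [h1.eventually h.locally_injective] with v hv hv1
    exact T.map_eq_zero_iff.1 (hv hv1)

theorem IsDualOf.comp_left {V V' A A' B : Type*} [NormedAddCommGroup V] [NormedSpace ℂ V]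
    [NormedAddCommGroup V'] [NormedSpace ℂ V'] [CommGroup A] [TopologicalSpace A]
    [CommGroup A'] [TopologicalSpace A'] [CommGroup B] [TopologicalSpace B]
    {e : V → A} {e' : V' → A'} {p : A →* B →* ℂˣ} (h : IsDualOf e p) (φ : A' ≃* A)
    (hφ' : Continuous φ.symm) (T : V' ≃L[ℂ] V)
    (he : ∀ v, φ (e' v) = e (T v)) : IsDualOf e' (p.comp φ.toMonoidHom) where
  apply_exp b := by
    obtain ⟨ℓ, hℓ⟩ := h.apply_exp b
    refine ⟨ℓ.comp (T : V' →L[ℂ] V), fun v => ?_⟩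
    have : (p.comp φ.toMonoidHom) (e' v) b = p (φ (e' v)) b := rfl
    rw [this, he, hℓ]
    rfl
  surjective χ hχ hℓ := by
    obtain ⟨ℓ, hℓ⟩ := hℓ
    obtain ⟨b, hb⟩ := h.surjective (χ.comp φ.symm.toMonoidHom) (hχ.comp hφ')
      ⟨ℓ.comp (T.symm : V →L[ℂ] V'), fun v => by
        have h1 : φ.symm (e v) = e' (T.symm v) := by
          rw [MulEquiv.symm_apply_eq, he, T.apply_symm_apply]
        have h2 : (χ.comp φ.symm.toMonoidHom) (e v) = χ (φ.symm (e v)) := rfl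
        rw [h2, h1, hℓ]
        rfl⟩
    refine ⟨b, fun a => ?_⟩
    have h3 := hb (φ a)
    have h4 : (χ.comp φ.symm.toMonoidHom) (φ a) = χ (φ.symm (φ a)) := rfl
    rw [h4, φ.symm_apply_apply] at h3
    exact h3
  nhds_one U hU := by
    obtain ⟨K, hK, ε, hε, h1⟩ := h.nhds_one U hU
    refine ⟨φ.symm '' K, hK.image hφ', ε, hε, fun b hb => h1 b fun a ha => ?_⟩
    have h2 := hb _ (Set.mem_image_of_mem φ.symm ha)
    have h3 : (p.comp φ.toMonoidHom) (φ.symm a) b = p (φ (φ.symm a)) b := rfl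
    rwa [h3, φ.apply_symm_apply] at h2
  bounded C := by
    obtain ⟨K, hK, h1⟩ := h.bounded fun a => C (φ.symm a)
    refine ⟨K, hK, fun b hb => h1 fun a => ?_⟩
    have h2 := hb (φ.symm a)
    have h3 : (p.comp φ.toMonoidHom) (φ.symm a) b = p (φ (φ.symm a)) b := rfl
    rwa [h3, φ.apply_symm_apply] at h2

theorem IsDualOf.comp_right {V A B B' : Type*} [NormedAddCommGroup V] [NormedSpace ℂ V]
    [CommGroup A] [TopologicalSpace A]
    [CommGroup B] [TopologicalSpace B] [CommGroup B'] [TopologicalSpace B']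
    {e : V → A} {p : A →* B →* ℂˣ} (h : IsDualOf e p) (φ : B' ≃* B)
    (hφ' : Continuous φ.symm) :
    IsDualOf e ((MonoidHom.compHom' φ.toMonoidHom).comp p) where
  apply_exp b := h.apply_exp (φ b)
  surjective χ hχ hℓ := by
    obtain ⟨b, hb⟩ := h.surjective χ hχ hℓ
    refine ⟨φ.symm b, fun a => ?_⟩
    have h1 : ((MonoidHom.compHom' φ.toMonoidHom).comp p) a (φ.symm b) = p a (φ (φ.symm b)) := rfl
    rw [h1, φ.apply_symm_apply, hb]
  nhds_one U hU := by
    obtain ⟨K, hK, ε, hε, h1⟩ := h.nhds_one (φ.symm ⁻¹' U) (by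
      refine hφ'.continuousAt ?_
      rwa [map_one])
    refine ⟨K, hK, ε, hε, fun b hb => ?_⟩
    have h2 := h1 (φ b) hb
    rwa [Set.mem_preimage, φ.symm_apply_apply] at h2
  bounded C := by
    obtain ⟨K, hK, h1⟩ := h.bounded C
    exact ⟨φ.symm '' K, hK.image hφ', fun b hb => ⟨φ b, h1 hb, φ.symm_apply_apply b⟩⟩

theorem IsPerfectPairing.comp_left {V V' W W' A A' B : Type*} [NormedAddCommGroup V]
    [NormedSpace ℂ V] [NormedAddCommGroup V'] [NormedSpace ℂ V'] [NormedAddCommGroup W]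
    [NormedSpace ℂ W] [NormedAddCommGroup W'] [NormedSpace ℂ W'] [CommGroup A]
    [TopologicalSpace A] [IsTopologicalGroup A]
    [CommGroup A'] [TopologicalSpace A'] [IsTopologicalGroup A'] [CommGroup B] [TopologicalSpace B]
    {e : V → A} {e' : V' → A'} {f : W → B} {p : A →* B →* ℂˣ} (h : IsPerfectPairing e f p)
    (he' : IsExp e') (φ : A' ≃* A) (T : V' ≃L[ℂ] V) (he : ∀ v, φ (e' v) = e (T v))
    (S : W' ≃L[ℂ] W) :
    IsPerfectPairing e' (fun w => f (S w)) (p.comp φ.toMonoidHom) := by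
  have hφ : Continuous φ := he'.continuous_of_comp_eq h.isExp_left φ.toMonoidHom T T.continuous
    (map_zero T) he
  have hφ' : Continuous φ.symm := h.isExp_left.continuous_of_comp_eq he' φ.symm.toMonoidHom T.symm
    T.symm.continuous (map_zero T.symm) fun v => by
      change φ.symm (e v) = _
      rw [MulEquiv.symm_apply_eq, he, T.apply_symm_apply]
  refine ⟨?_, he', h.isExp_right.comp_equiv S, h.left.comp_left φ hφ' T he, ?_,
    h.compactlyGenerated⟩
  · exact h.continuous.comp (f := fun x : A' × B => (φ x.1, x.2))
      ((hφ.comp continuous_fst).prodMk continuous_snd)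
  · have h1 := (h.right.comp_left (e' := fun w => f (S w)) (MulEquiv.refl B) continuous_id
      S fun _ => rfl).comp_right φ hφ'
    exact h1

/-- A compactly generated commutative complex Lie group whose points are separated by holomorphic
functions is in duality with a group of the form `ℤ^κ × ℂ^κ' × (ℂˣ)^j × F`, `F` finite. -/
theorem IsHolExp.exists_isPerfectPairing {n : ℕ} {E A : Type*} [NormedAddCommGroup E]
    [NormedSpace ℂ E] [CommGroup A] [TopologicalSpace A] [ChartedSpace E A]
    [IsTopologicalGroup A] {e : (Fin n → ℂ) → A} (he : IsHolExp (E := E) e)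
    (hsep : ∀ x y : A, x ≠ y → ∃ f : A → ℂ, ContMDiff 𝓘(ℂ, E) 𝓘(ℂ, ℂ) ω f ∧ f x ≠ f y)
    (hA : IsCompactlyGeneratedGroup A) :
    ∃ (m : ℕ) (B : Type) (_ : CommGroup B) (_ : TopologicalSpace B) (_ : IsTopologicalGroup B)
      (_ : T1Space B) (f : (Fin m → ℂ) → B) (p : A →* B →* ℂˣ), IsPerfectPairing e f p := by
  have hexp : IsExp e := he.isExp
  obtain ⟨κ, κ', _, _, T, hT⟩ := he.exists_coordinates hsep
  let A₁ := (κ → ℂˣ) × (κ' → Multiplicative ℂ)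
  let e₁ : (κ → ℂ) × (κ' → ℂ) → A₁ :=
    Prod.map (fun v i => expUnits (v i)) (fun v i => Multiplicative.ofAdd (v i))
  have he₁ : IsExp e₁ := isExp_expUnits.piMap.prodMap isExp_ofAdd.piMap
  have hker : ∀ v, e v = 1 ↔ e₁ (T v) = 1 := by
    intro v
    rw [hT]
    constructor
    · rintro ⟨h1, h2⟩
      exact Prod.ext (funext h1) (funext fun i => by
        change Multiplicative.ofAdd ((T v).2 i) = 1
        rw [h2]; rfl)
    · intro h
      exact ⟨fun i => congrFun (congrArg Prod.fst h) i,
        funext fun i => congrFun (congrArg Prod.snd h) i⟩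
  have he₁s : Function.Surjective e₁ := fun a =>
    ⟨(fun i => Complex.log (a.1 i), fun i => (a.2 i).toAdd),
      Prod.ext (funext fun i => expUnits_log _) rfl⟩
  let eh : Multiplicative (Fin n → ℂ) →* A :=
    MonoidHom.mk' (fun v => e v.toAdd) fun v w => hexp.map_add _ _
  let qh : Multiplicative (Fin n → ℂ) →* A₁ :=
    MonoidHom.mk' (fun v => e₁ (T v.toAdd)) fun v w => by
      rw [toAdd_mul, _root_.map_add, he₁.map_add]
  have hqs : Function.Surjective qh := fun a => by
    obtain ⟨w, hw⟩ := he₁s a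
    exact ⟨Multiplicative.ofAdd (T.symm w), by
      change e₁ (T (T.symm w)) = a
      rw [T.apply_symm_apply, hw]⟩
  let H : Subgroup A := eh.range
  have hHopen : IsOpen (H : Set A) := by
    have : (H : Set A) = Set.range e := rfl
    rw [this]
    exact hexp.isOpenMap.isOpen_range
  -- The maps `e` and `e₁ ∘ T` have the same kernel, so the second factors through the image `H` of
  -- the first.
  let f₀ : H →* A₁ := eh.rangeRestrict.liftOfSurjective eh.rangeRestrict_surjective
    ⟨qh, fun v hv => (hker v.toAdd).1 (congrArg Subtype.val hv)⟩
  have hf₀ : ∀ v, f₀ (eh.rangeRestrict v) = qh v := fun v =>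
    eh.rangeRestrict.liftOfRightInverse_comp_apply _ _ _ v
  obtain ⟨ρ, hρ⟩ := MonoidHom.exists_extension_of_surjective qh hqs H f₀
  have hρe : ∀ v, ρ (e v) = e₁ (T v) := fun v =>
    (hρ (eh.rangeRestrict (Multiplicative.ofAdd v))).trans (hf₀ (Multiplicative.ofAdd v))
  have hfg : Group.FG (A ⧸ H) := hA.fg_quotient hHopen
  obtain ⟨j, _, F, _, _, ⟨δ⟩⟩ := CommGroup.exists_equiv_free_prod_finite (A ⧸ H)
  let : TopologicalSpace F := ⊥
  have : DiscreteTopology F := ⟨rfl⟩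
  let : TopologicalSpace (F →* ℂˣ) := ⊥
  have : DiscreteTopology (F →* ℂˣ) := ⟨rfl⟩
  -- The extension `ρ` restricts to an isomorphism of `H` onto `A₁`, so together with the projection
  -- to `A ⧸ H` it splits the group.
  let φ₀ : A →* A₁ × ((j → Multiplicative ℤ) × F) :=
    ρ.prod (δ.toMonoidHom.comp (QuotientGroup.mk' H))
  have hδe : ∀ v, δ (QuotientGroup.mk' H (e v)) = 1 := fun v => by
    have : QuotientGroup.mk' H (e v) = 1 :=
      (QuotientGroup.eq_one_iff _).2 ⟨Multiplicative.ofAdd v, rfl⟩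
    rw [this, map_one]
  have hφ₀ : Function.Bijective φ₀ := by
    constructor
    · rw [injective_iff_map_eq_one]
      intro x hx
      have h1 : ρ x = 1 := congrArg Prod.fst hx
      have h2 : δ (QuotientGroup.mk' H x) = 1 := congrArg Prod.snd hx
      rw [map_eq_one_iff δ δ.injective] at h2
      obtain ⟨v, hv⟩ : x ∈ H := (QuotientGroup.eq_one_iff _).1 h2
      have hv' : e v.toAdd = x := hv
      rw [← hv', hρe, ← hker] at h1
      rw [← hv', h1]
    · rintro ⟨a, d⟩
      obtain ⟨x, hx⟩ := QuotientGroup.mk'_surjective H (δ.symm d)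
      obtain ⟨v, hv⟩ := hqs (a * (ρ x)⁻¹)
      refine ⟨x * e v.toAdd, Prod.ext ?_ ?_⟩
      · change ρ (x * e v.toAdd) = a
        have hv' : e₁ (T v.toAdd) = a * (ρ x)⁻¹ := hv
        rw [map_mul, hρe, hv', mul_comm, inv_mul_cancel_right]
      · change δ (QuotientGroup.mk' H (x * e v.toAdd)) = d
        rw [map_mul, map_mul, hδe, hx, mul_one, δ.apply_symm_apply]
  let φ := MulEquiv.ofBijective φ₀ hφ₀
  have hpair := ((isPerfectPairing_zpowPairing.pi κ).prod (isPerfectPairing_expPairing.pi κ')).prod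
    ((isPerfectPairing_flip_zpowPairing.pi j).prod (isPerfectPairing_eval F))
  -- The discrete factors add only a one-point space to the Lie algebra, so `T` extends to all
  -- factors.
  let : Unique ((j → PUnit.{1}) × PUnit.{1}) := Unique.mk' _
  let T' : (Fin n → ℂ) ≃L[ℂ] ((κ → ℂ) × (κ' → ℂ)) × ((j → PUnit) × PUnit) :=
    (T.trans LinearEquiv.prodUnique.symm).toContinuousLinearEquiv
  let W := ((κ → PUnit) × (κ' → ℂ)) × ((j → ℂ) × PUnit)
  let S : (Fin (Module.finrank ℂ W) → ℂ) ≃L[ℂ] W :=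
    (Module.finBasis ℂ W).equivFun.symm.toContinuousLinearEquiv
  exact ⟨_, _, inferInstance, inferInstance, inferInstance, inferInstance, _, _,
    hpair.comp_left hexp φ T' (fun v => Prod.ext (hρe v) (hδe v)) S⟩

/-! ### The dual Stein group and biduality -/

/-- A holomorphic homomorphism to `ℂˣ` is the exponential of its differential. -/
theorem IsExp.exists_linear_of_contMDiff {V A : Type*} [NormedAddCommGroup V] [NormedSpace ℂ V]
    [CommGroup A] [TopologicalSpace A] {e : V → A} (he : IsExp e) (χ : A →* ℂˣ)
    (hχ : ContMDiff 𝓘(ℂ, V) 𝓘(ℂ, ℂ) ω (fun v => χ (e v))) :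
    ∃ ℓ : V →L[ℂ] ℂ, ∀ v, (χ (e v) : ℂ) = Complex.exp (ℓ v) := by
  set f : V → ℂ := fun v => (χ (e v) : ℂ) with hf
  have hd : Differentiable ℂ f :=
    (contMDiff_units_iff.1 hχ).contDiff.differentiable (by simp)
  have hf0 : f 0 = 1 := by simp [hf, he.map_zero]
  have hmul : ∀ v w, f (v + w) = f v * f w := fun v w => by simp [hf, he.map_add]
  set ℓ := fderiv ℂ f 0 with hℓ
  have hderiv : ∀ v, HasFDerivAt f (f v • ℓ) v := by
    intro v
    have h1 : HasFDerivAt (fun w : V => w - v) (ContinuousLinearMap.id ℂ V) v :=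
      (hasFDerivAt_id v).sub_const v
    have h2 : HasFDerivAt f ℓ (v - v) := by
      rw [sub_self]; exact (hd 0).hasFDerivAt
    have h3 : HasFDerivAt (fun w => f (w - v)) (ℓ.comp (ContinuousLinearMap.id ℂ V)) v :=
      HasFDerivAt.comp v (f := fun w : V => w - v) h2 h1
    have h4 := h3.const_mul (f v)
    have h5 : (fun w => f v * f (w - v)) = f := funext fun w => by
      rw [← hmul]; simp
    rw [h5] at h4
    exact h4
  -- Multiplicativity gives the differential equation `f' = f ℓ`, so the quotient of `f` by `exp ℓ`
  -- has zero derivative and equals its value `1` at the origin.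
  have hconst : ∀ v, HasFDerivAt (fun w => f w * Complex.exp (-ℓ w)) (0 : V →L[ℂ] ℂ) v := by
    intro v
    have h1 : HasFDerivAt (fun w => Complex.exp (-ℓ w)) (Complex.exp (-ℓ v) • (-ℓ)) v :=
      ℓ.hasFDerivAt.neg.cexp
    refine ((hderiv v).mul h1).congr_fderiv ?_
    ext w
    simp
    ring
  refine ⟨ℓ, fun v => ?_⟩
  have h1 := is_const_of_fderiv_eq_zero (𝕜 := ℂ) (fun v => (hconst v).differentiableAt)
    (fun v => (hconst v).fderiv) v 0
  simp only [hf0, _root_.map_zero, neg_zero, Complex.exp_zero, mul_one] at h1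
  rw [Complex.exp_neg, mul_inv_eq_one₀ (Complex.exp_ne_zero _)] at h1
  exact h1

namespace AbSteinGrp

instance (G : AbSteinGrp.{u}) : IsTopologicalGroup G :=
  topologicalGroup_of_lieGroup 𝓘(ℂ, Fin G.dim → ℂ) ω

instance (G : AbSteinGrp.{u}) : T2Space G := by
  refine ⟨fun x y hxy => ?_⟩
  obtain ⟨f, hf, hne⟩ := G.stein.isStein.separable x y hxy
  exact separated_by_continuous (ContMDiff.continuous hf) hne

/-- The pairing of a group with its dual. -/
noncomputable def evalPairing (G : AbSteinGrp.{u}) : G →* G.dual →* ℂˣ :=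
  MonoidHom.mk' (fun x => MonoidHom.mk' (fun χ => χ.1 x) fun _ _ => rfl)
    fun x y => MonoidHom.ext fun χ => map_mul χ.1 x y

theorem evalPairing_apply (G : AbSteinGrp.{u}) (x : G) (χ : G.dual) :
    G.evalPairing x χ = χ.1 x := rfl

/-- A group in duality with `G` is isomorphic to the dual group. -/
theorem exists_mulEquiv_dual (G : AbSteinGrp.{u}) {V : Type*} [NormedAddCommGroup V]
    [NormedSpace ℂ V] {e : V → G} (he : IsHolExp (E := Fin G.dim → ℂ) e) {B : Type*} [CommGroup B]
    [TopologicalSpace B] [IsTopologicalGroup B] [T1Space B] {p : G →* B →* ℂˣ}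
    (hp : Continuous fun x : G × B => p x.1 x.2) (hdual : IsDualOf e p) :
    ∃ β : B ≃* G.dual, Continuous β ∧ Continuous β.symm ∧ ∀ b x, (β b).1 x = p x b := by
  have hhol : ∀ b, ContMDiff 𝓘(ℂ, Fin G.dim → ℂ) 𝓘(ℂ, ℂ) ω (p.flip b) := fun b => by
    obtain ⟨ℓ, hℓ⟩ := hdual.apply_exp b
    exact he.contMDiff_character (p.flip b) ℓ hℓ
  let β₀ : B →* G.dual := MonoidHom.mk' (fun b => ⟨⟨p.flip b, (hhol b).continuous⟩, hhol b⟩)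
    fun b b' => Subtype.ext (ContinuousMonoidHom.ext fun x => map_mul (p x) b b')
  have hβ₀ : ∀ b x, (β₀ b).1 x = p x b := fun _ _ => rfl
  have hbij : Function.Bijective β₀ := by
    constructor
    · rw [injective_iff_map_eq_one]
      intro b hb
      refine hdual.eq_one_of_apply_eq_one fun x => ?_
      rw [← hβ₀, hb]
      rfl
    · intro χ
      have hχ : ContMDiff 𝓘(ℂ, Fin G.dim → ℂ) 𝓘(ℂ, ℂ) ω (χ.1 : G → ℂˣ) := χ.2
      obtain ⟨b, hb⟩ := hdual.surjective χ.1.toMonoidHom hχ.continuous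
        (he.isExp.exists_linear_of_contMDiff χ.1.toMonoidHom (hχ.comp he.contMDiff))
      exact ⟨b, Subtype.ext (ContinuousMonoidHom.ext fun x => (hb x).symm)⟩
  let β := MulEquiv.ofBijective β₀ hbij
  have hind : IsInducing (fun χ : G.dual => (χ.1 : C(G, ℂˣ))) :=
    (ContinuousMonoidHom.isInducing_toContinuousMap G ℂˣ).comp IsInducing.subtypeVal
  refine ⟨β, ?_, ?_, hβ₀⟩
  · rw [hind.continuous_iff]
    exact ContinuousMap.continuous_of_continuous_uncurry _
      (hp.comp continuous_swap)
  · refine continuous_of_continuousAt_one β.symm ?_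
    rw [ContinuousAt, map_one]
    intro U hU
    -- Being `ε`-close to `1` on the compact set `K` is a compact-open neighbourhood of the trivial
    -- character, and it lands in `U`.
    obtain ⟨K, hK, ε, hε, hKU⟩ := hdual.nhds_one U hU
    have hopen : IsOpen {u : ℂˣ | ‖(u : ℂ) - 1‖ < ε} :=
      isOpen_lt (by fun_prop) continuous_const
    have h1 : {χ : G.dual | Set.MapsTo (χ.1 : C(G, ℂˣ)) K {u : ℂˣ | ‖(u : ℂ) - 1‖ < ε}} ∈
        𝓝 (1 : G.dual) := by
      refine ((ContinuousMap.isOpen_setOfPred_mapsTo hK hopen).preimage hind.continuous).mem_nhds ?_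
      intro x _
      change ‖((1 : ℂˣ) : ℂ) - 1‖ < ε
      simpa using hε
    refine mem_map.2 <| mem_of_superset h1 fun χ hχ => hKU _ fun a ha => ?_
    have h2 : p a (β.symm χ) = χ.1 a := by
      rw [← hβ₀]
      exact DFunLike.congr_fun (congrArg Subtype.val (β.apply_symm_apply χ)) a
    rw [h2]
    exact hχ ha

/-- The exponential map of `G`. -/
noncomputable def expMap (G : AbSteinGrp.{u}) : (Fin G.dim → ℂ) → G :=
  (LieGroup.exists_isHolExp (Fin G.dim → ℂ) G).choose

theorem isHolExp_expMap (G : AbSteinGrp.{u}) : IsHolExp (E := Fin G.dim → ℂ) G.expMap :=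
  (LieGroup.exists_isHolExp (Fin G.dim → ℂ) G).choose_spec

/-- The abstract dual `B` of the product decomposition is isomorphic to `G^•`, also topologically,
and transport along this isomorphism turns its pairing with `G` into evaluation. From here on all
statements about `G^•` are read off from the pairing. -/
theorem exists_isPerfectPairing_evalPairing (G : AbSteinGrp.{u}) :
    ∃ (m : ℕ) (f : (Fin m → ℂ) → G.dual), IsPerfectPairing G.expMap f G.evalPairing := by
  obtain ⟨m, B, _, _, _, _, f, p, h⟩ := G.isHolExp_expMap.exists_isPerfectPairing
    G.stein.isStein.separable G.compactlyGenerated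
  obtain ⟨β, hβ, hβ', hβp⟩ := G.exists_mulEquiv_dual G.isHolExp_expMap h.continuous h.left
  have hev : ∀ x χ, G.evalPairing x χ = p x (β.symm χ) := fun x χ => by
    rw [evalPairing_apply, ← hβp, β.apply_symm_apply]
  have hleft : G.evalPairing = (MonoidHom.compHom' β.symm.toMonoidHom).comp p :=
    MonoidHom.ext fun x => MonoidHom.ext fun χ => hev x χ
  have hright : G.evalPairing.flip = p.flip.comp β.symm.toMonoidHom :=
    MonoidHom.ext fun χ => MonoidHom.ext fun x => hev x χ
  refine ⟨m, fun w => β (f w), ⟨?_, h.isExp_left, ?_, ?_, ?_, ?_⟩⟩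
  · simp only [hev]
    exact h.continuous.comp (f := fun x : G × G.dual => (x.1, β.symm x.2))
      (continuous_fst.prodMk (hβ'.comp continuous_snd))
  · refine ⟨fun v w => by rw [h.isExp_right.map_add, map_mul], ?_, ?_⟩
    · have h1 : map β (𝓝 1) = 𝓝 1 := by
        have := (Homeomorph.mk β.toEquiv hβ hβ').map_nhds_eq 1
        have h2 : (Homeomorph.mk β.toEquiv hβ hβ') 1 = 1 := map_one β
        rw [h2] at this
        exact this
      rw [← h1, ← h.isExp_right.map_nhds, map_map]
      rfl
    · filter_upwards [h.isExp_right.locally_injective] with w hw hw1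
      exact hw ((map_eq_one_iff β β.injective).1 hw1)
  · rw [hleft]
    exact h.left.comp_right β.symm hβ
  · rw [hright]
    exact h.right.comp_left β.symm hβ (ContinuousLinearEquiv.refl ℂ _) fun w =>
      β.symm_apply_apply (f w)
  · obtain ⟨K, hK, hKt⟩ := h.compactlyGenerated
    refine ⟨β '' K, hK.image hβ, ?_⟩
    have : β '' K = β.toMonoidHom '' K := rfl
    rw [this, ← MonoidHom.map_closure, hKt]
    exact Subgroup.map_top_of_surjective _ β.surjective

/-- The complex dimension of the dual group. -/
noncomputable def dualDim (G : AbSteinGrp.{u}) : ℕ := G.exists_isPerfectPairing_evalPairing.choose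

/-- The exponential map of the dual group. -/
noncomputable def dualExpMap (G : AbSteinGrp.{u}) : (Fin G.dualDim → ℂ) → G.dual :=
  G.exists_isPerfectPairing_evalPairing.choose_spec.choose

theorem isPerfectPairing_evalPairing (G : AbSteinGrp.{u}) :
    IsPerfectPairing G.expMap G.dualExpMap G.evalPairing :=
  G.exists_isPerfectPairing_evalPairing.choose_spec.choose_spec

theorem exists_isSeparatingFamily_dual (G : AbSteinGrp.{u}) :
    ∃ ℓ, IsSeparatingFamily G.dualExpMap (fun x => G.evalPairing x) ℓ := by
  choose ℓ hℓ using G.isPerfectPairing_evalPairing.right.apply_exp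
  exact ⟨ℓ, hℓ, fun χ hχ => Subtype.ext (ContinuousMonoidHom.ext hχ)⟩

/-- The Stein group structure of the dual group. -/
noncomputable def dualStructure (G : AbSteinGrp.{u}) : SteinGroupStructure G.dual where
  dim := G.dualDim
  charts := G.isPerfectPairing_evalPairing.isExp_right.chartedSpace
  isLieGroup := G.isPerfectPairing_evalPairing.isExp_right.lieGroup
  -- Holomorphic convexity of the dual comes from the relative compactness of pointwise bounded sets
  -- of characters.
  isStein := G.isPerfectPairing_evalPairing.isExp_right.isSteinManifold
    G.exists_isSeparatingFamily_dual.choose_spec G.isPerfectPairing_evalPairing.left.bounded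

theorem isDualStructure_dualStructure (G : AbSteinGrp.{u}) : G.IsDualStructure G.dualStructure := by
  intro k M _ _ _ f
  let : ChartedSpace (Fin G.dualDim → ℂ) G.dual :=
    G.isPerfectPairing_evalPairing.isExp_right.chartedSpace
  have : LieGroup 𝓘(ℂ, Fin G.dualDim → ℂ) ω G.dual :=
    G.isPerfectPairing_evalPairing.isExp_right.lieGroup
  obtain ⟨ℓ, hℓ⟩ := G.exists_isSeparatingFamily_dual
  exact hℓ.contMDiff_iff (E := Fin G.dualDim → ℂ) G.isPerfectPairing_evalPairing.isExp_right.isHolExp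

theorem isCompactlyGeneratedGroup_dual (G : AbSteinGrp.{u}) : IsCompactlyGeneratedGroup G.dual := by
  obtain ⟨K, hK, hKt⟩ := G.isPerfectPairing_evalPairing.compactlyGenerated
  exact isCompactlyGeneratedGroup_of_closure hK hKt

/-- The dual group. -/
noncomputable abbrev dualGrp (G : AbSteinGrp.{u}) : AbSteinGrp.{u} :=
  G.dualObj G.dualStructure G.isCompactlyGeneratedGroup_dual

/-- The perfect pairing read from the other side says that `G` is dual to `G^•`, and the description
of dual groups, applied to `G^•`, identifies `G` with its bidual. -/
theorem exists_mulEquiv_bidual (G : AbSteinGrp.{u}) :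
    ∃ β : G ≃* G.dualGrp.dual, Continuous β ∧ Continuous β.symm ∧
      ∀ (x : G) (χ : G.dual), (β x).1 χ = χ.1 x :=
  G.dualGrp.exists_mulEquiv_dual (p := G.evalPairing.flip)
    G.isPerfectPairing_evalPairing.isExp_right.isHolExp
    (G.isPerfectPairing_evalPairing.continuous.comp continuous_swap)
    G.isPerfectPairing_evalPairing.right

/-- The evaluation isomorphism from `G` to its bidual. -/
noncomputable def bidualEquiv (G : AbSteinGrp.{u}) : G ≃* G.dualGrp.dual :=
  G.exists_mulEquiv_bidual.choose

theorem bidualEquiv_apply (G : AbSteinGrp.{u}) (x : G) (χ : G.dual) :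
    (G.bidualEquiv x).1 χ = χ.1 x :=
  G.exists_mulEquiv_bidual.choose_spec.2.2 x χ

theorem holomorphic_bidualEquiv (G : AbSteinGrp.{u}) :
    letI := G.dualGrp.dualStructure.charts
    ContMDiff 𝓘(ℂ, Fin G.dim → ℂ) 𝓘(ℂ, Fin G.dualGrp.dualStructure.dim → ℂ) ω G.bidualEquiv := by
  let := G.dualGrp.dualStructure.charts
  refine (G.dualGrp.isDualStructure_dualStructure G.dim G G.bidualEquiv).2
    ⟨G.exists_mulEquiv_bidual.choose_spec.1, fun χ => ?_⟩
  have h1 : (fun x => (G.bidualEquiv x).1 χ) = χ.1 := funext fun x => G.bidualEquiv_apply x χ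
  exact h1 ▸ χ.2

/-- The characters of `G` separate its points, so they test holomorphy of maps into `G`. Composed
with the inverse map, the character `χ` becomes evaluation at `χ` on the bidual, which is
holomorphic there. -/
theorem holomorphic_bidualEquiv_symm (G : AbSteinGrp.{u}) :
    letI := G.dualGrp.dualStructure.charts
    ContMDiff 𝓘(ℂ, Fin G.dualGrp.dualStructure.dim → ℂ) 𝓘(ℂ, Fin G.dim → ℂ) ω
      G.bidualEquiv.symm := by
  let := G.dualGrp.dualStructure.charts
  have := G.dualGrp.dualStructure.isStein.isManifold
  choose ℓ hℓ using G.isPerfectPairing_evalPairing.left.apply_exp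
  have hsep : IsSeparatingFamily G.expMap (fun χ => G.evalPairing.flip χ) ℓ :=
    ⟨hℓ, fun x hx => G.isPerfectPairing_evalPairing.right.eq_one_of_apply_eq_one hx⟩
  refine (hsep.contMDiff_iff G.isHolExp_expMap).2
    ⟨G.exists_mulEquiv_bidual.choose_spec.2.1, fun χ => ?_⟩
  have h1 : ∀ Φ : G.dualGrp.dual, G.evalPairing.flip χ (G.bidualEquiv.symm Φ) = Φ.1 χ := fun Φ => by
    rw [MonoidHom.flip_apply, evalPairing_apply, ← bidualEquiv_apply, MulEquiv.apply_symm_apply]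
  simp only [h1]
  exact ((G.dualGrp.isDualStructure_dualStructure _ G.dualGrp.dual id).1 contMDiff_id).2 χ

theorem hom_ext {G H : AbSteinGrp.{u}} {f g : G ⟶ H} (h : ∀ x, f.toMonoidHom x = g.toMonoidHom x) :
    f = g := by
  obtain ⟨f, hf⟩ := f
  obtain ⟨g, hg⟩ := g
  obtain rfl : f = g := MonoidHom.ext h
  rfl

/-- The evaluation isomorphism, as an isomorphism of Stein groups. -/
noncomputable def bidualIso (G : AbSteinGrp.{u}) : G ≅ G.dualGrp.dualGrp where
  hom := ⟨G.bidualEquiv.toMonoidHom, G.holomorphic_bidualEquiv⟩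
  inv := ⟨G.bidualEquiv.symm.toMonoidHom, G.holomorphic_bidualEquiv_symm⟩
  hom_inv_id := hom_ext G.bidualEquiv.symm_apply_apply
  inv_hom_id := hom_ext G.bidualEquiv.apply_symm_apply

end AbSteinGrp

theorem mainTheorem6 :
    ∃ (s : ∀ G : AbSteinGrp.{u}, SteinGroupStructure G.dual)
      (hs : ∀ G : AbSteinGrp.{u}, AbSteinGrp.IsDualStructure G (s G))
      (hc : ∀ G : AbSteinGrp.{u}, IsCompactlyGeneratedGroup G.dual)
      (i : 𝟭 AbSteinGrp.{u} ≅
        (AbSteinGrp.dualFunctor s hs hc).rightOp ⋙ AbSteinGrp.dualFunctor s hs hc),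
      ∀ (G : AbSteinGrp.{u}) (x : G) (χ : G.dual),
        ((i.hom.app G).toMonoidHom x : (G.dualObj (s G) (hc G)).dual).1 χ = χ.1 x := by
  refine ⟨AbSteinGrp.dualStructure, AbSteinGrp.isDualStructure_dualStructure,
    AbSteinGrp.isCompactlyGeneratedGroup_dual, NatIso.ofComponents AbSteinGrp.bidualIso ?_,
    fun G x χ => G.bidualEquiv_apply x χ⟩
  intro G H φ
  refine AbSteinGrp.hom_ext fun x => Subtype.ext (ContinuousMonoidHom.ext fun χ => ?_)
  -- Naturality: both composites send `x` to the functional with value `χ (φ x)` at `χ`.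
  exact (H.bidualEquiv_apply (φ x) χ).trans
    (G.bidualEquiv_apply x (AbSteinGrp.dualMap φ χ)).symm
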